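/- Let $P_1,P_2\in\mathbb R[s]$ with $\deg P_1=\deg P_2=1$ and leading coefficients $p_{d_1},p_{d_2}$, let $A_1(x)=a_{10}+a_{11}x+a_{12}x^2$, $A_2(x)=a_{20}+a_{21}x$ be real polynomials and $A_3\in\mathbb R$. Consider on $\mathbb R^3$ the differential system $\dot x=F_1$, $\dot y=F_2$, $\dot z=F_3$ with $$F_1(x,y)=P_1\big(y+A_1(x)\big),\qquad F_2(x,y,z)=P_2\Big(z+\tfrac{1}{p_{d_2}}A_2(x)\Big)-A_1'(x)F_1(x,y),$$ $$F_3(x,y)=-\tfrac1{p_{d_2}}\Big[-\tfrac12A_1''(x)F_1(x,y)^2+A_2'(x)F_1(x,y)\Big]+A_3 .$$ A trajectory is a solution on its maximal interval of existence. It goes to infinity in forward (backward) time if it eventually leaves every compact set as $t$ tends to the right (left) end of that interval. 1. If $\deg A_1\le 1$ (i.e. $a_{12}=0$), then every nontrivial (nonconstant) trajectory goes to infinity in forward and backward time. 2. If $\deg A_1=2$, put $\mu:=A_3\,a_{12}\,p_{d_2}\,p_{d_1}^2$. (a) If $\mu>0$, then every trajectory goes to infinity in forward and backward time. (b) If $\mu=0$,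 then there is a unique cuspidal invariant surface $\mathcal S_0$ of the system, and every trajectory in $\mathbb R^3\setminus\mathcal S_0$ goes to infinity in forward and backward time. Here a cuspidal invariant surface is an invariant algebraic surface, i.e. the zero set of a nonconstant polynomial $f\in\mathbb R[x,y,z]$ with $F_1f_x+F_2f_y+F_3f_z=Kf$ for some $K\in\mathbb R[x,y,z]$, that some $C^\infty$ diffeomorphism of $\mathbb R^3$ maps onto the cylinder $\mathbb R\times\{(y,z):z^2=y^3\}$ over the cuspidal cubic. (c) If $\mu<0$, then there is a unique isochronous periodic surface $\mathcal S_\mu$ of the system; it is homeomorphic to the cylinder $\mathbb R\times\mathbb S^1$, and every trajectory in $\mathbb R^3\setminus\mathcal S_\mu$ goes to infinity in forward and backward time. Here a periodic surface is a nonempty closed embedded $C^\infty$ two-dimensional submanifold of $\mathbb R^3$ (without boundary) foliated by (nonconstant) periodic orbits of the system; it is isochronous if all its periodic orbits have the same minimal period. -/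

import Mathlib

open scoped ContDiff

noncomputable section

namespace NilpotentField

/-- Phase space `ℝ³`, with coordinates `x = p 0`, `y = p 1`, `z = p 2`. -/
abbrev Space : Type := Fin 3 → ℝ

/-- The first component `F₁(x,y) = P₁(y + A₁(x))`. -/
def F₁ (P₁ A₁ : Polynomial ℝ) (x y : ℝ) : ℝ :=
  P₁.eval (y + A₁.eval x)

/-- The second component
`F₂(x,y,z) = P₂(z + A₂(x) / (d₂ p_{d₂})) - A₁'(x) F₁(x,y)`. -/
def F₂ (P₁ P₂ A₁ A₂ : Polynomial ℝ) (x y z : ℝ) : ℝ :=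
  P₂.eval (z + 1 / (P₂.natDegree * P₂.leadingCoeff) * A₂.eval x)
    - A₁.derivative.eval x * F₁ P₁ A₁ x y

/-- The third component
`F₃(x,y) = -(1 / (d₂ p_{d₂})) [-(1/2) A₁''(x) F₁(x,y)² + A₂'(x) F₁(x,y)] + A₃`. -/
def F₃ (P₁ P₂ A₁ A₂ : Polynomial ℝ) (A₃ : ℝ) (x y : ℝ) : ℝ :=
  -(1 / (P₂.natDegree * P₂.leadingCoeff))
      * (-(1 / 2) * A₁.derivative.derivative.eval x * (F₁ P₁ A₁ x y) ^ 2
          + A₂.derivative.eval x * F₁ P₁ A₁ x y)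
    + A₃

/-- The vector field `F = (F₁, F₂, F₃)` on `ℝ³`. -/
def field (P₁ P₂ A₁ A₂ : Polynomial ℝ) (A₃ : ℝ) (p : Space) : Space :=
  ![F₁ P₁ A₁ (p 0) (p 1), F₂ P₁ P₂ A₁ A₂ (p 0) (p 1) (p 2),
    F₃ P₁ P₂ A₁ A₂ A₃ (p 0) (p 1)]

/-- `γ` solves `γ' = F(γ)` on the nonempty open interval `I`
(possibly unbounded; the values of `γ` outside `I` are irrelevant). -/
structure IsSolutionOn (F : Space → Space) (γ : ℝ → Space) (I : Set ℝ) : Prop where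
  isOpen : IsOpen I
  ordConnected : I.OrdConnected
  nonempty : I.Nonempty
  hasDerivAt : ∀ t ∈ I, HasDerivAt γ (F (γ t)) t

/-- A trajectory of `F`: a solution with its maximal interval of existence `I`. -/
structure IsTrajectory (F : Space → Space) (γ : ℝ → Space) (I : Set ℝ) : Prop
    extends IsSolutionOn F γ I where
  maximal : ∀ (δ : ℝ → Space) (J : Set ℝ), IsSolutionOn F δ J → I ⊆ J → Set.EqOn γ δ I → J ⊆ I

/-- The trajectory is not reduced to a point. -/
def IsNontrivial (γ : ℝ → Space) (I : Set ℝ) : Prop :=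
  ∃ s ∈ I, ∃ t ∈ I, γ s ≠ γ t

/-- `γ` goes to infinity in forward and in backward time: it leaves every compact set for good
as `t` tends to the right end and to the left end of its interval `I`. -/
def EscapesBothWays (γ : ℝ → Space) (I : Set ℝ) : Prop :=
  ∀ K : Set Space, IsCompact K →
    (∃ t₀ ∈ I, ∀ t ∈ I, t₀ ≤ t → γ t ∉ K) ∧ (∃ t₀ ∈ I, ∀ t ∈ I, t ≤ t₀ → γ t ∉ K)

/-- `S` is an invariant algebraic surface of the vector field `F`: the zero set of a nonconstant
polynomial `f` with `⟨F, ∇f⟩ = K f` for some polynomial `K` (the cofactor). In particular, this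
covers every level set of every polynomial first integral (`K = 0`). -/
def IsInvariantAlgebraic (F : Space → Space) (S : Set Space) : Prop :=
  ∃ f K : MvPolynomial (Fin 3) ℝ, f.totalDegree ≠ 0 ∧
    S = {p | MvPolynomial.eval p f = 0} ∧
    ∀ p : Space, ∑ i, F p i * MvPolynomial.eval p (MvPolynomial.pderiv i f)
      = MvPolynomial.eval p K * MvPolynomial.eval p f

/-- The standard cuspidal surface `ℝ × {z² = y³}`, the cylinder over the cuspidal cubic. -/
def standardCuspidal : Set Space := {p | (p 2) ^ 2 = (p 1) ^ 3}

/-- `S` is a cuspidal surface: some `C^∞` diffeomorphism of `ℝ³` maps it onto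
`ℝ × {z² = y³}`. -/
def IsCuspidal (S : Set Space) : Prop :=
  ∃ e : Space ≃ Space, ContDiff ℝ ∞ e ∧ ContDiff ℝ ∞ e.symm ∧ e '' S = standardCuspidal

/-- A cuspidal invariant surface of `F`. -/
def IsCuspidalInvariantSurface (F : Space → Space) (S : Set Space) : Prop :=
  IsInvariantAlgebraic F S ∧ IsCuspidal S

/-- A (regular) surface: a nonempty closed subset of `ℝ³` that is locally the zero set of a `C^∞`
function without critical points, i.e. a closed embedded two-dimensional submanifold. -/
def IsRegularSurface (S : Set Space) : Prop :=
  S.Nonempty ∧ IsClosed S ∧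
    ∀ p ∈ S, ∃ U : Set Space, IsOpen U ∧ p ∈ U ∧ ∃ g : Space → ℝ,
      ContDiffOn ℝ ∞ g U ∧ (∀ q ∈ U, fderiv ℝ g q ≠ 0) ∧ S ∩ U = {q ∈ U | g q = 0}

/-- `γ` is a periodic orbit of `F` with (minimal) period `T > 0`. The minimality
excludes equilibria. -/
structure IsPeriodicOrbit (F : Space → Space) (γ : ℝ → Space) (T : ℝ) : Prop where
  hasDerivAt : ∀ t, HasDerivAt γ (F (γ t)) t
  pos : 0 < T
  periodic : Function.Periodic γ T
  minimal : ∀ s, 0 < s → s < T → ¬ Function.Periodic γ s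

/-- A periodic surface of `F`: a surface that is foliated by periodic orbits. -/
def IsPeriodicSurface (F : Space → Space) (S : Set Space) : Prop :=
  IsRegularSurface S ∧
    ∀ p ∈ S, ∃ (γ : ℝ → Space) (T : ℝ), IsPeriodicOrbit F γ T ∧ γ 0 = p ∧ Set.range γ ⊆ S

/-- An isochronous periodic surface: all its periodic orbits have the same period. -/
def IsIsochronousPeriodicSurface (F : Space → Space) (S : Set Space) : Prop :=
  IsPeriodicSurface F S ∧
    ∃ T : ℝ, ∀ (γ : ℝ → Space) (T' : ℝ), IsPeriodicOrbit F γ T' → Set.range γ ⊆ S → T' = T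

/-- `μ = A₃ a₁₂ p_{d₂} p_{d₁}²`, where `a₁₂` is the coefficient of `x²` in `A₁`. -/
def mu (P₁ P₂ A₁ : Polynomial ℝ) (A₃ : ℝ) : ℝ :=
  A₃ * A₁.coeff 2 * P₂.leadingCoeff * P₁.leadingCoeff ^ 2

end NilpotentField

end

/-!
Along a trajectory, `x''' = (p_{d₁} A₁''(x) / 2) (x')² + p_{d₁} p_{d₂} A₃`. Hence, for a suitable
constant `l ≠ 0`, the map `(l x, l x', l x'')` is a polynomial automorphism of the space conjugating
the system to `x' = u`, `u' = v`, `v' = a u² + b`, where `a = 0` if `deg A₁ ≤ 1`, and `a = 3/2`,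
`b = 2μ/3` if `deg A₁ = 2`. This conserves the energy `v² - (2a/3) u³ - 2 b u`.

A trajectory that does not go to infinity keeps returning to a compact set, and then it exists for
all forward times. If `b ≥ 0`, or if `a = 0`, then `v'` has a constant sign, so that `v` and `u` are
eventually monotone. Therefore `u` and `v` converge, recurrence forces both limits to be `0`, and
`b = 0` follows. The energy vanishes: for `a = 0` the trajectory is an equilibrium, for `a = 3/2` it
lies on the cuspidal surface `v² = u³`.

If `b < 0`, a returning trajectory turns along a closed oval of a level curve, and over each turn
`x` drifts by an integral that depends strictly monotonically on the shape of the oval. Exactly one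
oval has drift `0`, and it carries the periodic cylinder. Any other periodic surface is contained
and open in this connected cylinder, hence equal to it.

Uniqueness of the cuspidal surface: restricted to a level curve of the energy, an invariant
polynomial is constant, by differential algebra in the coordinate ring of the curve. So the surface
is a union of level sets, a single one by connectedness, and the cusp forces the level `0`.
-/

namespace NilpotentField

open Filter Set Topology

/-! ### Uniqueness and continuation of solutions -/

section Solutions

variable {F : Space → Space} {γ δ : ℝ → Space} {I J : Set ℝ} {s t : ℝ}

lemma IsSolutionOn.mono (h : IsSolutionOn F γ I) (hJo : IsOpen J) (hJc : J.OrdConnected)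
    (hJn : J.Nonempty) (hJI : J ⊆ I) : IsSolutionOn F γ J :=
  ⟨hJo, hJc, hJn, fun t ht => h.hasDerivAt t (hJI ht)⟩

lemma IsSolutionOn.eventually_hasDerivAt (h : IsSolutionOn F γ I) (ht : t ∈ I) :
    ∀ᶠ r in 𝓝 t, HasDerivAt γ (F (γ r)) r :=
  mem_of_superset (h.isOpen.mem_nhds ht) h.hasDerivAt

lemma IsSolutionOn.continuousAt (h : IsSolutionOn F γ I) (ht : t ∈ I) : ContinuousAt γ t :=
  (h.hasDerivAt t ht).continuousAt

lemma IsSolutionOn.comp_sub_const (h : IsSolutionOn F γ (Ioo (-s) s)) (t : ℝ) :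
    IsSolutionOn F (fun r => γ (r - t)) (Ioo (t - s) (t + s)) := by
  have hs : -s < s := nonempty_Ioo.1 h.nonempty
  refine ⟨isOpen_Ioo, ordConnected_Ioo, nonempty_Ioo.2 (by linarith), fun r hr => ?_⟩
  exact (h.hasDerivAt (r - t) ⟨by linarith [hr.1], by linarith [hr.2]⟩).comp_sub_const r t

lemma IsSolutionOn.eventuallyEq (hF : ContDiff ℝ 1 F) (hγ : IsSolutionOn F γ I)
    (hδ : IsSolutionOn F δ J) (htI : t ∈ I) (htJ : t ∈ J) (h : γ t = δ t) : γ =ᶠ[𝓝 t] δ := by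
  obtain ⟨K, U, hU, hK⟩ := (hF.contDiffAt (x := γ t)).exists_lipschitzOnWith
  refine ODE_solution_unique_of_eventually (v := fun _ => F) (s := fun _ => U)
    (Eventually.of_forall fun _ => hK) ?_ ?_ h
  · exact (hγ.eventually_hasDerivAt htI).and ((hγ.continuousAt htI).eventually_mem hU)
  · exact (hδ.eventually_hasDerivAt htJ).and ((hδ.continuousAt htJ).eventually_mem (h ▸ hU))

lemma IsSolutionOn.eqOn (hF : ContDiff ℝ 1 F) (hγ : IsSolutionOn F γ I) (hδ : IsSolutionOn F δ I)
    (hs : s ∈ I) (h : γ s = δ s) : EqOn γ δ I := by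
  suffices I ⊆ {t | γ =ᶠ[𝓝 t] δ} from fun t ht => (this ht).eq_of_nhds
  refine hγ.ordConnected.isPreconnected.subset_of_closure_inter_subset
    isOpen_setOfPred_eventually_nhds ⟨s, hs, hγ.eventuallyEq hF hδ hs hs h⟩ ?_
  rintro t ⟨htc, ht⟩
  refine hγ.eventuallyEq hF hδ ht ht (tendsto_nhds_unique_of_frequently_eq
    (hγ.continuousAt ht) (hδ.continuousAt ht) ?_)
  exact (mem_closure_iff_frequently.1 htc).mono fun r hr => hr.eq_of_nhds

open scoped Classical in
lemma IsSolutionOn.union (hF : ContDiff ℝ 1 F) (hγ : IsSolutionOn F γ I)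
    (hδ : IsSolutionOn F δ J) (hsI : s ∈ I) (hsJ : s ∈ J) (h : γ s = δ s) :
    IsSolutionOn F (I.piecewise γ δ) (I ∪ J) := by
  have hIJ : EqOn γ δ (I ∩ J) := by
    have ho := hγ.isOpen.inter hδ.isOpen
    have hc := hγ.ordConnected.inter hδ.ordConnected
    exact (hγ.mono ho hc ⟨s, hsI, hsJ⟩ inter_subset_left).eqOn hF
      (hδ.mono ho hc ⟨s, hsI, hsJ⟩ inter_subset_right) ⟨hsI, hsJ⟩ h
  have hJ : EqOn (I.piecewise γ δ) δ J := fun t ht => by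
    by_cases htI : t ∈ I
    · rw [piecewise_eq_of_mem _ _ _ htI, hIJ ⟨htI, ht⟩]
    · exact piecewise_eq_of_notMem _ _ _ htI
  refine ⟨hγ.isOpen.union hδ.isOpen, ?_, hγ.nonempty.inl, ?_⟩
  · exact (hγ.ordConnected.isPreconnected.union s hsI hsJ
      hδ.ordConnected.isPreconnected).ordConnected
  · rintro t (ht | ht)
    · rw [piecewise_eq_of_mem _ _ _ ht]
      exact (hγ.hasDerivAt t ht).congr_of_eventuallyEq
        ((piecewise_eqOn I γ δ).eventuallyEq_of_mem (hγ.isOpen.mem_nhds ht))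
    · rw [hJ ht]
      exact (hδ.hasDerivAt t ht).congr_of_eventuallyEq
        (hJ.eventuallyEq_of_mem (hδ.isOpen.mem_nhds ht))

lemma IsTrajectory.subset_of_isSolutionOn (hF : ContDiff ℝ 1 F) (hγ : IsTrajectory F γ I)
    (hδ : IsSolutionOn F δ J) (hsI : s ∈ I) (hsJ : s ∈ J) (h : γ s = δ s) : J ⊆ I := by
  classical
  exact subset_union_right.trans <| hγ.maximal _ _ (hγ.union hF hδ hsI hsJ h) subset_union_left
    (piecewise_eqOn I γ δ).symm

lemma IsSolutionOn.isTrajectory_univ (h : IsSolutionOn F γ univ) : IsTrajectory F γ univ :=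
  ⟨h, fun _ _ _ _ _ => subset_univ _⟩

lemma exists_isSolutionOn_Ioo_of_isCompact (hF : ContDiff ℝ 1 F) {K : Set Space}
    (hK : IsCompact K) :
    ∃ ε > 0, ∀ p ∈ K, ∃ δ : ℝ → Space, δ 0 = p ∧ IsSolutionOn F δ (Ioo (-ε) ε) := by
  refine hK.induction_on ⟨1, one_pos, fun p hp => absurd hp (notMem_empty p)⟩ ?_ ?_ ?_
  · rintro K L hKL ⟨ε, hε, h⟩
    exact ⟨ε, hε, fun p hp => h p (hKL hp)⟩
  · rintro K L ⟨ε, hε, hK⟩ ⟨ρ, hρ, hL⟩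
    refine ⟨min ε ρ, lt_min hε hρ, fun p hp => ?_⟩
    have hne : (Ioo (-min ε ρ) (min ε ρ)).Nonempty := nonempty_Ioo.2 (neg_lt_self (lt_min hε hρ))
    rcases hp with hp | hp
    · obtain ⟨δ, hδ₀, hδ⟩ := hK p hp
      exact ⟨δ, hδ₀, hδ.mono isOpen_Ioo ordConnected_Ioo hne
        (Ioo_subset_Ioo (neg_le_neg (min_le_left ε ρ)) (min_le_left ε ρ))⟩
    · obtain ⟨δ, hδ₀, hδ⟩ := hL p hp
      exact ⟨δ, hδ₀, hδ.mono isOpen_Ioo ordConnected_Ioo hne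
        (Ioo_subset_Ioo (neg_le_neg (min_le_right ε ρ)) (min_le_right ε ρ))⟩
  · intro p₀ _
    obtain ⟨r, hr, ε, hε, h⟩ :=
      (hF.contDiffAt (x := p₀)).exists_forall_mem_closedBall_exists_eq_forall_mem_Ioo_hasDerivAt 0
    simp only [zero_sub, zero_add] at h
    refine ⟨Metric.closedBall p₀ r, mem_nhdsWithin_of_mem_nhds (Metric.closedBall_mem_nhds p₀ hr),
      ε, hε, fun p hp => ?_⟩
    obtain ⟨δ, hδ₀, hδ⟩ := h p hp
    exact ⟨δ, hδ₀, isOpen_Ioo, ordConnected_Ioo, nonempty_Ioo.2 (neg_lt_self hε), hδ⟩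

/-- The curve `γ` meets some compact set arbitrarily late in `I`: the negation of escaping to
infinity in forward time. -/
def ReturnsForward (γ : ℝ → Space) (I : Set ℝ) : Prop :=
  ∃ K : Set Space, IsCompact K ∧ ∀ t₀ ∈ I, ∃ t ∈ I, t₀ ≤ t ∧ γ t ∈ K

/-- The time of existence is bounded below by some `ε` on the compact set to which `γ` returns,
so `I` extends at least `ε` beyond times arbitrarily close to its right end. -/
lemma IsTrajectory.Ici_subset (hF : ContDiff ℝ 1 F) (h : IsTrajectory F γ I)
    (hret : ReturnsForward γ I) (ht : t ∈ I) : Ici t ⊆ I := by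
  obtain ⟨K, hK, hret⟩ := hret
  obtain ⟨ε, hε, hex⟩ := exists_isSolutionOn_Ioo_of_isCompact hF hK
  have hext : ∀ r ∈ I, ∃ s ∈ I, r + ε / 2 ≤ s := fun r hr => by
    obtain ⟨s, hs, hrs, hsK⟩ := hret r hr
    obtain ⟨δ, hδ₀, hδ⟩ := hex (γ s) hsK
    have hsub := h.subset_of_isSolutionOn hF (hδ.comp_sub_const s) hs
      (by constructor <;> linarith) (by simp [hδ₀])
    exact ⟨s + ε / 2, hsub (by constructor <;> linarith), by linarith⟩
  have hunbdd : ¬ BddAbove I := fun hI => by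
    obtain ⟨r, hr, hlt⟩ := exists_lt_of_lt_csSup h.nonempty
      (show sSup I - ε / 2 < sSup I by linarith)
    obtain ⟨s, hs, hle⟩ := hext r hr
    linarith [le_csSup hI hs]
  intro r hr
  obtain ⟨s, hs, hrs⟩ := not_bddAbove_iff.1 hunbdd r
  exact h.ordConnected.out ht hs ⟨hr, hrs.le⟩

end Solutions

/-! ### Smooth conjugation -/

lemma contDiff_vec₃ {E : Type*} [NormedAddCommGroup E] [NormedSpace ℝ E] {n : WithTop ℕ∞}
    {f g h : E → ℝ} (hf : ContDiff ℝ n f) (hg : ContDiff ℝ n g) (hh : ContDiff ℝ n h) :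
    ContDiff ℝ n fun p => ![f p, g p, h p] :=
  contDiff_pi.2 (Fin.forall_fin_succ.2 ⟨hf, Fin.forall_fin_succ.2 ⟨hg, Fin.forall_fin_one.2 hh⟩⟩)

section Diffeomorphism

variable {e : Space ≃ Space}

lemma EscapesBothWays.of_comp {f : Space → Space} (hf : Continuous f) {γ : ℝ → Space} {I : Set ℝ}
    (h : EscapesBothWays (f ∘ γ) I) : EscapesBothWays γ I := by
  intro K hK
  obtain ⟨⟨s, hs, hfwd⟩, ⟨t, ht, hbwd⟩⟩ := h (f '' K) (hK.image hf)
  exact ⟨⟨s, hs, fun r hr hsr hrK => hfwd r hr hsr (Set.mem_image_of_mem f hrK)⟩,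
    ⟨t, ht, fun r hr hrt hrK => hbwd r hr hrt (Set.mem_image_of_mem f hrK)⟩⟩

lemma fderiv_symm_fderiv_apply (he : Differentiable ℝ e) (he' : Differentiable ℝ e.symm)
    (p v : Space) : fderiv ℝ e.symm (e p) (fderiv ℝ e p v) = v := by
  have hcomp := fderiv_comp p (he' (e p)) (he p)
  rw [e.symm_comp_self, fderiv_id] at hcomp
  exact (DFunLike.congr_fun hcomp v).symm

lemma IsRegularSurface.image (he : ContDiff ℝ ∞ e) (he' : ContDiff ℝ ∞ e.symm) {S : Set Space}
    (hS : IsRegularSurface S) : IsRegularSurface (e '' S) := by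
  obtain ⟨hne, hclosed, hloc⟩ := hS
  refine ⟨hne.image e, ?_, ?_⟩
  · rw [e.image_eq_preimage_symm]
    exact hclosed.preimage he'.continuous
  rintro _ ⟨p, hp, rfl⟩
  obtain ⟨U, hU, hpU, g, hg, hg', hSU⟩ := hloc p hp
  refine ⟨e.symm ⁻¹' U, hU.preimage he'.continuous, by rwa [Set.mem_preimage, e.symm_apply_apply],
    g ∘ e.symm, hg.comp he'.contDiffOn fun _ hq => hq, fun q hq hzero => hg' _ hq ?_, ?_⟩
  · have hgq : DifferentiableAt ℝ (g ∘ e.symm) q :=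
      ((hg.contDiffAt (hU.mem_nhds hq)).comp q he'.contDiffAt).differentiableAt (by simp)
    have hchain := fderiv_comp (e.symm q) (g := g ∘ e.symm) (by rwa [e.apply_symm_apply])
      (he.differentiable (by simp) (e.symm q))
    rwa [e.apply_symm_apply, hzero, ContinuousLinearMap.zero_comp, Function.comp_assoc,
      e.symm_comp_self, Function.comp_id] at hchain
  · rw [e.image_eq_preimage_symm, ← Set.preimage_inter, hSU]
    rfl

lemma IsCuspidal.image (he : ContDiff ℝ ∞ e) (he' : ContDiff ℝ ∞ e.symm) {S : Set Space}
    (hS : IsCuspidal S) : IsCuspidal (e '' S) := by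
  obtain ⟨f, hf, hf', hfS⟩ := hS
  refine ⟨e.symm.trans f, hf.comp he', he.comp hf', ?_⟩
  rw [← hfS, ← Set.image_comp]
  congr 1
  ext1 p
  simp

end Diffeomorphism

/-- The `C^∞` diffeomorphism `e` of `ℝ³` carries the vector field `F` to `G`. It is used to bring
the vector field of the theorem to a normal form. -/
structure IsConj (e : Space ≃ Space) (F G : Space → Space) : Prop where
  contDiff : ContDiff ℝ ∞ e
  contDiff_symm : ContDiff ℝ ∞ e.symm
  fderiv_apply : ∀ p, fderiv ℝ e p (F p) = G (e p)

namespace IsConj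

variable {e : Space ≃ Space} {F G : Space → Space} {γ : ℝ → Space} {I : Set ℝ} {S : Set Space}

lemma differentiable (h : IsConj e F G) : Differentiable ℝ e :=
  h.contDiff.differentiable (by simp)

lemma symm (h : IsConj e F G) : IsConj e.symm G F := by
  refine ⟨h.contDiff_symm, h.contDiff, fun q => ?_⟩
  have hinv := fderiv_symm_fderiv_apply h.differentiable
    (h.contDiff_symm.differentiable (by simp)) (e.symm q) (F (e.symm q))
  rwa [h.fderiv_apply, e.apply_symm_apply] at hinv

lemma hasDerivAt_comp (h : IsConj e F G) {t : ℝ} (hγ : HasDerivAt γ (F (γ t)) t) :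
    HasDerivAt (e ∘ γ) (G ((e ∘ γ) t)) t := by
  have hderiv := (h.differentiable (γ t)).hasFDerivAt.comp_hasDerivAt t hγ
  rwa [h.fderiv_apply] at hderiv

lemma isSolutionOn (h : IsConj e F G) (hγ : IsSolutionOn F γ I) : IsSolutionOn G (e ∘ γ) I :=
  ⟨hγ.isOpen, hγ.ordConnected, hγ.nonempty, fun t ht => h.hasDerivAt_comp (hγ.hasDerivAt t ht)⟩

lemma isTrajectory (h : IsConj e F G) (hγ : IsTrajectory F γ I) : IsTrajectory G (e ∘ γ) I := by
  refine ⟨h.isSolutionOn hγ.toIsSolutionOn, fun δ J hδ hIJ heq => ?_⟩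
  refine hγ.maximal (e.symm ∘ δ) J (h.symm.isSolutionOn hδ) hIJ fun t ht => ?_
  rw [Function.comp_apply, ← heq ht, Function.comp_apply, e.symm_apply_apply]

lemma isPeriodicOrbit (h : IsConj e F G) {T : ℝ} (hγ : IsPeriodicOrbit F γ T) :
    IsPeriodicOrbit G (e ∘ γ) T :=
  ⟨fun t => h.hasDerivAt_comp (hγ.hasDerivAt t), hγ.pos, hγ.periodic.comp e,
    fun s hs hsT hper => hγ.minimal s hs hsT fun t => e.injective (hper t)⟩

lemma isPeriodicSurface (h : IsConj e F G) (hS : IsPeriodicSurface F S) :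
    IsPeriodicSurface G (e '' S) := by
  refine ⟨hS.1.image h.contDiff h.contDiff_symm, ?_⟩
  rintro _ ⟨p, hp, rfl⟩
  obtain ⟨γ, T, hγ, rfl, hγS⟩ := hS.2 p hp
  refine ⟨e ∘ γ, T, h.isPeriodicOrbit hγ, rfl, ?_⟩
  rw [Set.range_comp]
  exact Set.image_mono hγS

lemma isIsochronousPeriodicSurface (h : IsConj e F G) (hS : IsIsochronousPeriodicSurface F S) :
    IsIsochronousPeriodicSurface G (e '' S) := by
  obtain ⟨hper, T, hT⟩ := hS
  refine ⟨h.isPeriodicSurface hper, T, fun γ T' hγ hγS => ?_⟩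
  refine hT (e.symm ∘ γ) T' (h.symm.isPeriodicOrbit hγ) ?_
  rw [Set.range_comp, ← Set.image_subset_image_iff e.injective, e.image_symm_image]
  exact hγS

end IsConj

/-! ### Functions of a real variable -/

section Real

variable {f f' : ℝ → ℝ} {C m s t T : ℝ}

lemma eq_of_hasDerivAt_zero {I : Set ℝ} (hI : IsOpen I) (hc : I.OrdConnected)
    (hf : ∀ t ∈ I, HasDerivAt f 0 t) (hs : s ∈ I) (ht : t ∈ I) : f s = f t :=
  hI.is_const_of_deriv_eq_zero hc.isPreconnected
    (fun r hr => (hf r hr).differentiableAt.differentiableWithinAt)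
    (fun r hr => (hf r hr).deriv) hs ht

lemma exists_monotoneOn_Ici (hf : ∀ᶠ t in atTop, HasDerivAt f (f' t) t)
    (hf' : ∀ᶠ t in atTop, 0 ≤ f' t) : ∃ t₀, MonotoneOn f (Ici t₀) := by
  obtain ⟨t₀, h⟩ := eventually_atTop.1 (hf.and hf')
  refine ⟨t₀, monotoneOn_of_deriv_nonneg (convex_Ici t₀)
    (fun t ht => (h t ht).1.continuousAt.continuousWithinAt)
    (fun t ht => (h t (interior_subset ht)).1.differentiableAt.differentiableWithinAt)
    fun t ht => ?_⟩
  rw [(h t (interior_subset ht)).1.deriv]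
  exact (h t (interior_subset ht)).2

lemma tendsto_atTop_of_tendsto_deriv (hf : ∀ᶠ t in atTop, HasDerivAt f (f' t) t)
    (hf' : Tendsto f' atTop (𝓝 m)) (hm : 0 < m) : Tendsto f atTop atTop := by
  obtain ⟨t₀, hmono⟩ := exists_monotoneOn_Ici (f := fun t => f t - m / 2 * t)
    (f' := fun t => f' t - m / 2)
    (hf.mono fun t ht => ht.sub (by simpa using (hasDerivAt_id t).const_mul (m / 2)))
    ((hf'.eventually_const_lt (half_lt_self hm)).mono fun t ht => sub_nonneg.2 ht.le)
  refine tendsto_atTop_mono' atTop ?_ (tendsto_atTop_add_const_right atTop (f t₀ - m / 2 * t₀)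
    (tendsto_id.const_mul_atTop (half_pos hm)))
  filter_upwards [eventually_ge_atTop t₀] with t ht
  have hle := hmono self_mem_Ici ht ht
  simp only [id_eq]
  linarith

lemma eq_zero_of_tendsto_deriv (hf : ∀ᶠ t in atTop, HasDerivAt f (f' t) t)
    (hf' : Tendsto f' atTop (𝓝 m)) (hC : ∃ᶠ t in atTop, |f t| ≤ C) : m = 0 := by
  rcases lt_trichotomy m 0 with hm | hm | hm
  · have hlim := tendsto_atTop_of_tendsto_deriv (hf.mono fun t ht => ht.neg) hf'.neg
      (neg_pos.2 hm)
    exact (hC ((hlim.eventually_gt_atTop C).mono fun t ht =>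
      not_le.2 (ht.trans_le (neg_le_abs (f t))))).elim
  · exact hm
  · have hlim := tendsto_atTop_of_tendsto_deriv hf hf' hm
    exact (hC ((hlim.eventually_gt_atTop C).mono fun t ht =>
      not_le.2 (ht.trans_le (le_abs_self (f t))))).elim

lemma exists_tendsto_of_deriv_nonneg (hf : ∀ᶠ t in atTop, HasDerivAt f (f' t) t)
    (hf' : ∀ᶠ t in atTop, 0 ≤ f' t) (hC : ∃ᶠ t in atTop, |f t| ≤ C) :
    ∃ l, Tendsto f atTop (𝓝 l) := by
  obtain ⟨t₀, hmono⟩ := exists_monotoneOn_Ici hf hf'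
  have hmax : Monotone fun t => f (max t t₀) := fun r s hrs =>
    hmono (le_max_right r t₀) (le_max_right s t₀) (max_le_max_right t₀ hrs)
  have hbdd : BddAbove (range fun t => f (max t t₀)) := by
    refine ⟨C, forall_mem_range.2 fun t => ?_⟩
    obtain ⟨s, hs, hsC⟩ := frequently_atTop.1 hC (max t t₀)
    exact (hmono (le_max_right t t₀) ((le_max_right t t₀).trans hs) hs).trans
      ((le_abs_self (f s)).trans hsC)
  refine ⟨_, (tendsto_atTop_ciSup hmax hbdd).congr' ?_⟩
  filter_upwards [eventually_ge_atTop t₀] with t ht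
  rw [max_eq_left ht]

lemma exists_tendsto_of_deriv_signed (hf : ∀ᶠ t in atTop, HasDerivAt f (f' t) t)
    (hf' : (∀ᶠ t in atTop, 0 ≤ f' t) ∨ ∀ᶠ t in atTop, f' t ≤ 0)
    (hC : ∃ᶠ t in atTop, |f t| ≤ C) : ∃ l, Tendsto f atTop (𝓝 l) := by
  rcases hf' with hf' | hf'
  · exact exists_tendsto_of_deriv_nonneg hf hf' hC
  · obtain ⟨l, hl⟩ := exists_tendsto_of_deriv_nonneg (f := fun t => -f t) (f' := fun t => -f' t)
      (hf.mono fun t ht => ht.neg) (hf'.mono fun t ht => neg_nonneg.2 ht)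
      (by simpa only [abs_neg] using hC)
    exact ⟨-l, by simpa only [neg_neg] using hl.neg⟩

lemma eventually_signed_of_deriv_nonneg (hf : ∀ᶠ t in atTop, HasDerivAt f (f' t) t)
    (hf' : ∀ᶠ t in atTop, 0 ≤ f' t) :
    (∀ᶠ t in atTop, 0 ≤ f t) ∨ ∀ᶠ t in atTop, f t ≤ 0 := by
  obtain ⟨t₀, hmono⟩ := exists_monotoneOn_Ici hf hf'
  refine or_iff_not_imp_right.2 fun hneg => ?_
  obtain ⟨s, hs, hpos⟩ := frequently_atTop.1 (not_eventually.1 hneg) t₀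
  filter_upwards [eventually_ge_atTop s] with t ht
  exact (not_le.1 hpos).le.trans (hmono hs (hs.trans ht) ht)

lemma eventually_signed_of_deriv_signed (hf : ∀ᶠ t in atTop, HasDerivAt f (f' t) t)
    (hf' : (∀ᶠ t in atTop, 0 ≤ f' t) ∨ ∀ᶠ t in atTop, f' t ≤ 0) :
    (∀ᶠ t in atTop, 0 ≤ f t) ∨ ∀ᶠ t in atTop, f t ≤ 0 := by
  rcases hf' with hf' | hf'
  · exact eventually_signed_of_deriv_nonneg hf hf'
  · have hneg := eventually_signed_of_deriv_nonneg (f := fun t => -f t) (f' := fun t => -f' t)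
      (hf.mono fun t ht => ht.neg) (hf'.mono fun t ht => neg_nonneg.2 ht)
    simpa only [neg_nonneg, neg_nonpos] using hneg.symm

lemma exists_tendsto_of_tendsto_sq {l : ℝ} (hl : Tendsto (fun t => f t ^ 2) atTop (𝓝 l))
    (hf : (∀ᶠ t in atTop, 0 ≤ f t) ∨ ∀ᶠ t in atTop, f t ≤ 0) :
    ∃ m, Tendsto f atTop (𝓝 m) := by
  have habs : Tendsto (fun t => |f t|) atTop (𝓝 √l) := by
    simpa only [Real.sqrt_sq_eq_abs] using hl.sqrt
  rcases hf with hf | hf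
  · exact ⟨√l, habs.congr' (hf.mono fun t ht => abs_of_nonneg ht)⟩
  · exact ⟨-√l, habs.neg.congr' (hf.mono fun t ht => by rw [abs_of_nonpos ht, neg_neg])⟩

lemma exists_zeros_of_frequently_sign (hf : ContinuousOn f (Ici s))
    (hneg : ∃ᶠ t in atTop, f t < 0) (hpos : ∃ᶠ t in atTop, 0 < f t) :
    ∃ p q r, s ≤ p ∧ p < q ∧ q < r ∧ f p = 0 ∧ f q ≠ 0 ∧ f r = 0 := by
  obtain ⟨t₁, hst₁, ht₁⟩ := frequently_atTop.1 hneg s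
  obtain ⟨t₂, h₁₂, ht₂⟩ := frequently_atTop.1 hpos t₁
  obtain ⟨t₃, h₂₃, ht₃⟩ := frequently_atTop.1 hneg t₂
  obtain ⟨p, hp, hp0⟩ : (0 : ℝ) ∈ f '' Icc t₁ t₂ := intermediate_value_Icc h₁₂
    (hf.mono fun t ht => hst₁.trans ht.1) ⟨ht₁.le, ht₂.le⟩
  obtain ⟨r, hr, hr0⟩ : (0 : ℝ) ∈ f '' Icc t₂ t₃ := intermediate_value_Icc' h₂₃
    (hf.mono fun t ht => (hst₁.trans h₁₂).trans ht.1) ⟨ht₃.le, ht₂.le⟩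
  refine ⟨p, t₂, r, hst₁.trans hp.1, hp.2.lt_of_ne ?_, hr.1.lt_of_ne' ?_, hp0, ht₂.ne', hr0⟩
  · rintro rfl
    exact ht₂.ne' hp0
  · rintro rfl
    exact ht₂.ne' hr0

lemma exists_isMaxOn_Icc_deriv_eq_zero (hst : s ≤ t)
    (hf : ∀ r ∈ Icc s t, HasDerivAt f (f' r) r) (hs : f' s = 0) (ht : f' t = 0) :
    ∃ r ∈ Icc s t, f' r = 0 ∧ ∀ q ∈ Icc s t, f q ≤ f r := by
  obtain ⟨r, hr, hmax⟩ := isCompact_Icc.exists_isMaxOn (nonempty_Icc.2 hst)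
    (fun r hr => (hf r hr).continuousAt.continuousWithinAt)
  refine ⟨r, hr, ?_, hmax⟩
  rcases hr.1.eq_or_lt with rfl | hsr
  · exact hs
  rcases hr.2.eq_or_lt with rfl | hrt
  · exact ht
  exact (hmax.isLocalMax (Icc_mem_nhds hsr hrt)).hasDerivAt_eq_zero (hf r hr)

lemma exists_image_Icc_eq_Icc_deriv_eq_zero (hst : s ≤ t)
    (hf : ∀ r ∈ Icc s t, HasDerivAt f (f' r) r) (hs : f' s = 0) (ht : f' t = 0) :
    ∃ p ∈ Icc s t, ∃ q ∈ Icc s t, f' p = 0 ∧ f' q = 0 ∧ f '' Icc s t = Icc (f p) (f q) := by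
  obtain ⟨q, hq, hq0, hmax⟩ := exists_isMaxOn_Icc_deriv_eq_zero hst hf hs ht
  obtain ⟨p, hp, hp0, hmin⟩ := exists_isMaxOn_Icc_deriv_eq_zero (f := fun r => -f r)
    (f' := fun r => -f' r) hst (fun r hr => (hf r hr).neg) (neg_eq_zero.2 hs) (neg_eq_zero.2 ht)
  refine ⟨p, hp, q, hq, neg_eq_zero.1 hp0, hq0, Subset.antisymm ?_ ?_⟩
  · exact image_subset_iff.2 fun r hr => ⟨neg_le_neg_iff.1 (hmin r hr), hmax r hr⟩
  · exact isPreconnected_Icc.intermediate_value hp hq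
      (fun r hr => (hf r hr).continuousAt.continuousWithinAt)

lemma exists_apply_ne_of_deriv_ne_zero {q : ℝ} (hsq : s < q) (hqt : q < t)
    (hf : HasDerivAt f m q) (hm : m ≠ 0) (c : ℝ) : ∃ r ∈ Icc s t, f r ≠ c := by
  by_contra! hconst
  refine hm (hf.unique ((hasDerivAt_const q c).congr_of_eventuallyEq ?_))
  filter_upwards [Icc_mem_nhds hsq hqt] with r hr using hconst r hr

lemma eq_zero_of_frequently_of_translation (hf : Continuous f) (hT : 0 < T)
    (hadd : ∀ t, f (t + T) = f t + m) (hC : ∃ᶠ t in atTop, |f t| ≤ C) : m = 0 := by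
  have hper : Function.Periodic (fun t => f t - m / T * t) T := fun t => by
    simp only [hadd]
    field_simp
    ring
  obtain ⟨B, hB⟩ := (hper.compact_of_continuous hT.ne' (by fun_prop)).isBounded.exists_norm_le
  have hslope : m / T = 0 := by
    refine eq_zero_of_tendsto_deriv (f := fun t => m / T * t) (f' := fun _ => m / T) (C := B + C)
      (Eventually.of_forall fun t => by simpa using (hasDerivAt_id t).const_mul (m / T))
      tendsto_const_nhds (hC.mono fun t ht => ?_)
    have hBt : |f t - m / T * t| ≤ B := hB _ (mem_range_self t)
    linarith [abs_sub_abs_le_abs_sub (m / T * t) (f t), abs_sub_comm (m / T * t) (f t)]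
  exact (div_eq_zero_iff.1 hslope).resolve_right hT.ne'

lemma exists_primitive_periodic (hf : Continuous f) (hper : Function.Periodic f T) :
    ∃ g : ℝ → ℝ, g 0 = 0 ∧ (∀ t, HasDerivAt g (f t) t) ∧
      ∀ t, g (t + T) = g t + ∫ s in (0 : ℝ)..T, f s := by
  refine ⟨fun t => ∫ s in (0 : ℝ)..t, f s, intervalIntegral.integral_same,
    fun t => (hf.integral_hasStrictDerivAt 0 t).hasDerivAt, fun t => ?_⟩
  simpa only [zero_add] using
    hper.intervalIntegral_add_eq_add 0 t fun _ _ => hf.intervalIntegrable _ _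

end Real

/-! ### The normal form `x' = u`, `u' = v`, `v' = a u² + b` -/

/-- The vector field of the third order equation `x''' = a (x')² + b` in the coordinates
`(x, u, v) = (x, x', x'')`. The field of the theorem is conjugate to one of this form. -/
noncomputable def normalField (a b : ℝ) (p : Space) : Space := ![p 1, p 2, a * p 1 ^ 2 + b]

/-- The first integral `v² - (2a/3) u³ - 2 b u` of `normalField a b`. -/
noncomputable def energy (a b : ℝ) (p : Space) : ℝ := p 2 ^ 2 - 2 * a / 3 * p 1 ^ 3 - 2 * b * p 1

/-- The reversing symmetry `(x, u, v) ↦ (-x, u, -v)` of `normalField a b`. -/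
def reflect (p : Space) : Space := ![-p 0, p 1, -p 2]

/-- The cylinder over the oval of the cubic curve `v² = (r² - (u + n)²) (2 n - u)`. The oval is the
part of the curve with `-n - r ≤ u ≤ -n + r`; the condition `u < 2 n` cuts off the unbounded
branch. -/
def ovalCylinder (n r : ℝ) : Set Space :=
  {p | p 2 ^ 2 = (r ^ 2 - (p 1 + n) ^ 2) * (2 * n - p 1) ∧ p 1 < 2 * n}

/-- The condition for the curve of `ovalCylinder n r` to contain a nondegenerate oval and to be a
level set of `energy (3 / 2) b`. -/
structure IsOval (b n r : ℝ) : Prop where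
  pos : 0 < r
  lt : r < 3 * n
  eq : 3 * n ^ 2 + r ^ 2 = -2 * b

lemma contDiff_normalField (a b : ℝ) {n : WithTop ℕ∞} : ContDiff ℝ n (normalField a b) :=
  contDiff_vec₃ (by fun_prop) (by fun_prop) (by fun_prop)

lemma reflect_reflect (p : Space) : reflect (reflect p) = p := by
  ext i
  fin_cases i <;> simp [reflect]

lemma continuous_reflect : Continuous reflect :=
  (contDiff_vec₃ (n := 0) (by fun_prop) (by fun_prop) (by fun_prop)).continuous

section Solutions

variable {F : Space → Space} {γ : ℝ → Space} {I : Set ℝ} {a b s t : ℝ}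

lemma hasDerivAt_normalField_iff : HasDerivAt γ (normalField a b (γ t)) t ↔
    HasDerivAt (fun r => γ r 0) (γ t 1) t ∧ HasDerivAt (fun r => γ r 1) (γ t 2) t ∧
      HasDerivAt (fun r => γ r 2) (a * γ t 1 ^ 2 + b) t := by
  rw [hasDerivAt_pi, Fin.forall_fin_succ, Fin.forall_fin_succ, Fin.forall_fin_one]
  rfl

lemma IsSolutionOn.energy_eq (h : IsSolutionOn (normalField a b) γ I) (hs : s ∈ I) (ht : t ∈ I) :
    energy a b (γ s) = energy a b (γ t) := by
  refine eq_of_hasDerivAt_zero (f := fun r => energy a b (γ r)) h.isOpen h.ordConnected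
    (fun r hr => ?_) hs ht
  obtain ⟨-, hu, hv⟩ := hasDerivAt_normalField_iff.1 (h.hasDerivAt r hr)
  refine (((hv.pow 2).sub ((hu.pow 3).const_mul (2 * a / 3))).sub
    (hu.const_mul (2 * b))).congr_deriv ?_
  push_cast
  ring

lemma IsSolutionOn.velocity_eq_zero_of_equilibrium (h : IsSolutionOn (normalField a b) γ I)
    (hs : s ∈ I) (ht : t ∈ I) (hv : γ s 2 = 0) (hu : a * γ s 1 ^ 2 + b = 0) : γ t 2 = 0 := by
  have hline : IsSolutionOn (normalField a b)
      (fun r => ![γ s 0 + γ s 1 * (r - s), γ s 1, 0]) I := by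
    refine ⟨h.isOpen, h.ordConnected, h.nonempty, fun r _ =>
      hasDerivAt_normalField_iff.2 ⟨?_, ?_, ?_⟩⟩
    · simpa using (((hasDerivAt_id r).sub_const s).const_mul (γ s 1)).const_add (γ s 0)
    · exact hasDerivAt_const r (γ s 1)
    · exact (hasDerivAt_const r (0 : ℝ)).congr_deriv hu.symm
  have heq := h.eqOn (contDiff_normalField a b) hline hs
    (by ext i; fin_cases i <;> simp [hv]) ht
  exact congrFun heq 2

/-! ### Time reversal -/

lemma IsSolutionOn.reverse (h : IsSolutionOn (normalField a b) γ I) :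
    IsSolutionOn (normalField a b) (fun t => reflect (γ (-t))) (-I) := by
  refine ⟨h.isOpen.neg, ⟨fun s hs t ht r hr => ?_⟩, h.nonempty.neg, fun t ht => ?_⟩
  · exact h.ordConnected.out ht hs ⟨neg_le_neg hr.2, neg_le_neg hr.1⟩
  · obtain ⟨hx, hu, hv⟩ := hasDerivAt_normalField_iff.1 (h.hasDerivAt (-t) ht)
    have hneg := hasDerivAt_neg t
    refine hasDerivAt_normalField_iff.2 ⟨?_, ?_, ?_⟩
    · exact (hx.scomp t hneg).neg.congr_deriv (by simp [reflect])
    · exact (hu.scomp t hneg).congr_deriv (by simp [reflect])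
    · exact (hv.scomp t hneg).neg.congr_deriv (by simp [reflect])

lemma IsTrajectory.reverse (h : IsTrajectory (normalField a b) γ I) :
    IsTrajectory (normalField a b) (fun t => reflect (γ (-t))) (-I) := by
  refine ⟨h.toIsSolutionOn.reverse, fun δ J hδ hIJ heq => ?_⟩
  rw [← neg_subset_neg, neg_neg]
  refine h.maximal _ (-J) hδ.reverse (by rwa [← neg_subset_neg, neg_neg]) fun t ht => ?_
  rw [← heq (show -t ∈ -I by rwa [Set.mem_neg, neg_neg]), reflect_reflect, neg_neg]

lemma escapesBothWays_of_not_returnsForward (hfwd : ¬ ReturnsForward γ I)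
    (hbwd : ¬ ReturnsForward (fun t => reflect (γ (-t))) (-I)) : EscapesBothWays γ I := by
  intro K hK
  simp only [ReturnsForward, not_exists, not_and, not_forall] at hfwd hbwd
  obtain ⟨s, hs, hfwd⟩ := hfwd K hK
  obtain ⟨t, ht, hbwd⟩ := hbwd (reflect '' K) (hK.image continuous_reflect)
  refine ⟨⟨s, hs, fun r hr hsr => hfwd r hr hsr⟩, ⟨-t, ht, fun r hr hrt hrK => ?_⟩⟩
  refine hbwd (-r) (by rwa [Set.mem_neg, neg_neg]) (le_neg_of_le_neg hrt) ?_
  rw [neg_neg]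
  exact mem_image_of_mem reflect hrK

/-! ### Returning trajectories -/

lemma IsTrajectory.eventually_mem (hF : ContDiff ℝ 1 F) (h : IsTrajectory F γ I)
    (hret : ReturnsForward γ I) : ∀ᶠ t in atTop, t ∈ I :=
  let ⟨t₀, ht₀⟩ := h.nonempty
  mem_of_superset (Ici_mem_atTop t₀) (h.Ici_subset hF hret ht₀)

lemma ReturnsForward.frequently_abs_le (hret : ReturnsForward γ I) (hI : ∀ᶠ t in atTop, t ∈ I) :
    ∃ C, ∀ i, ∃ᶠ t in atTop, |γ t i| ≤ C := by
  obtain ⟨K, hK, hret⟩ := hret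
  obtain ⟨C, hC⟩ := hK.isBounded.exists_norm_le
  refine ⟨C, fun i => frequently_atTop.2 fun s => ?_⟩
  obtain ⟨t₀, ht₀, hst₀⟩ := (hI.and (eventually_ge_atTop s)).exists
  obtain ⟨t, -, ht₀t, htK⟩ := hret t₀ ht₀
  exact ⟨t, hst₀.trans ht₀t, (norm_le_pi_norm (γ t) i).trans (hC _ htK)⟩

lemma IsTrajectory.eventually_hasDerivAt_normalField (h : IsTrajectory (normalField a b) γ I)
    (hret : ReturnsForward γ I) : ∀ᶠ t in atTop, HasDerivAt (fun r => γ r 0) (γ t 1) t ∧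
      HasDerivAt (fun r => γ r 1) (γ t 2) t ∧
      HasDerivAt (fun r => γ r 2) (a * γ t 1 ^ 2 + b) t :=
  (h.eventually_mem (contDiff_normalField a b) hret).mono fun t ht =>
    hasDerivAt_normalField_iff.1 (h.hasDerivAt t ht)

/-- Conservation of energy turns convergence of the monotone function `u` into that of `v²`. -/
lemma IsTrajectory.exists_tendsto_of_velocity_signed (h : IsTrajectory (normalField a b) γ I)
    (hret : ReturnsForward γ I)
    (hv : (∀ᶠ t in atTop, 0 ≤ γ t 2) ∨ ∀ᶠ t in atTop, γ t 2 ≤ 0) :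
    ∃ l m, Tendsto (fun t => γ t 1) atTop (𝓝 l) ∧ Tendsto (fun t => γ t 2) atTop (𝓝 m) := by
  have hI := h.eventually_mem (contDiff_normalField a b) hret
  obtain ⟨C, hC⟩ := hret.frequently_abs_le hI
  obtain ⟨l, hl⟩ := exists_tendsto_of_deriv_signed
    ((h.eventually_hasDerivAt_normalField hret).mono fun t ht => ht.2.1) hv (hC 1)
  obtain ⟨t₀, ht₀⟩ := h.nonempty
  have hsq : Tendsto (fun t => γ t 2 ^ 2) atTop
      (𝓝 (energy a b (γ t₀) + 2 * a / 3 * l ^ 3 + 2 * b * l)) := by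
    refine ((((hl.pow 3).const_mul (2 * a / 3)).const_add _).add (hl.const_mul (2 * b))).congr' ?_
    filter_upwards [hI] with t ht
    rw [h.energy_eq ht₀ ht, energy]
    ring
  obtain ⟨m, hm⟩ := exists_tendsto_of_tendsto_sq hsq hv
  exact ⟨l, m, hl, hm⟩

lemma IsTrajectory.tendsto_zero_of_velocity_signed (h : IsTrajectory (normalField a b) γ I)
    (hret : ReturnsForward γ I)
    (hv : (∀ᶠ t in atTop, 0 ≤ γ t 2) ∨ ∀ᶠ t in atTop, γ t 2 ≤ 0) :
    b = 0 ∧ Tendsto (fun t => γ t 1) atTop (𝓝 0) ∧ Tendsto (fun t => γ t 2) atTop (𝓝 0) := by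
  obtain ⟨l, m, hl, hm⟩ := h.exists_tendsto_of_velocity_signed hret hv
  obtain ⟨C, hC⟩ := hret.frequently_abs_le (h.eventually_mem (contDiff_normalField a b) hret)
  have hd := h.eventually_hasDerivAt_normalField hret
  obtain rfl := eq_zero_of_tendsto_deriv (hd.mono fun t ht => ht.1) hl (hC 0)
  obtain rfl := eq_zero_of_tendsto_deriv (hd.mono fun t ht => ht.2.1) hm (hC 1)
  have hb := eq_zero_of_tendsto_deriv (hd.mono fun t ht => ht.2.2)
    (((hl.pow 2).const_mul a).add_const b) (hC 2)
  exact ⟨by simpa using hb, hl, hm⟩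

lemma IsTrajectory.tendsto_zero_of_forcing_signed (h : IsTrajectory (normalField a b) γ I)
    (hret : ReturnsForward γ I) (hab : (∀ u : ℝ, 0 ≤ a * u ^ 2 + b) ∨ ∀ u : ℝ, a * u ^ 2 + b ≤ 0) :
    b = 0 ∧ Tendsto (fun t => γ t 1) atTop (𝓝 0) ∧ Tendsto (fun t => γ t 2) atTop (𝓝 0) := by
  refine h.tendsto_zero_of_velocity_signed hret (eventually_signed_of_deriv_signed
    ((h.eventually_hasDerivAt_normalField hret).mono fun t ht => ht.2.2) ?_)
  exact hab.imp (fun hab => Eventually.of_forall fun t => hab _)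
    (fun hab => Eventually.of_forall fun t => hab _)

/-! ### Returning trajectories with `a = 3/2` and `b < 0` meet an oval cylinder -/

lemma add_two_mul_nonpos_of_cubic_nonneg {m M : ℝ} (hmM : m < M)
    (h : ∀ u ∈ Icc m M, 0 ≤ (u - m) * (u - M) * (u + m + M)) : m + 2 * M ≤ 0 := by
  by_contra! hpos
  obtain ⟨u, hu, huM⟩ := exists_between (show max m (-m - M) < M from max_lt hmM (by linarith))
  obtain ⟨hmu, hroot⟩ := max_lt_iff.1 hu
  have hneg : 0 < (u - m) * (M - u) * (u + m + M) :=
    mul_pos (mul_pos (by linarith) (by linarith)) (by linarith)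
  linarith [h u ⟨hmu.le, huM.le⟩]

/-- On `[s, t]`, the function `u` has a minimum `m` and a maximum `M`, both attained with `v = 0`,
so that `m` and `M` are two of the roots of the cubic that `u` satisfies by conservation of
energy. -/
lemma IsSolutionOn.exists_roots (h : IsSolutionOn (normalField (3 / 2) b) γ I) {q : ℝ}
    (hst : Icc s t ⊆ I) (hsq : s < q) (hqt : q < t) (hs : γ s 2 = 0) (ht : γ t 2 = 0)
    (hq : γ q 2 ≠ 0) :
    ∃ m M, m < M ∧ m + 2 * M < 0 ∧ m ^ 2 + m * M + M ^ 2 = -2 * b ∧ γ s 1 ≤ M ∧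
      γ s 2 ^ 2 = (γ s 1 - m) * (γ s 1 - M) * (γ s 1 + m + M) := by
  have hd r (hr : r ∈ Icc s t) : HasDerivAt (fun r => γ r 1) (γ r 2) r :=
    (hasDerivAt_normalField_iff.1 (h.hasDerivAt r (hst hr))).2.1
  have hqI : q ∈ Icc s t := ⟨hsq.le, hqt.le⟩
  have hsI : s ∈ Icc s t := left_mem_Icc.2 (hsq.trans hqt).le
  obtain ⟨p, hp, P, hP, hp0, hP0, himage⟩ :=
    exists_image_Icc_eq_Icc_deriv_eq_zero (hsq.trans hqt).le hd hs ht
  have hrange r (hr : r ∈ Icc s t) : γ r 1 ∈ Icc (γ p 1) (γ P 1) :=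
    himage ▸ mem_image_of_mem (fun r => γ r 1) hr
  have hlt : γ p 1 < γ P 1 := by
    obtain ⟨r, hr, hne⟩ := exists_apply_ne_of_deriv_ne_zero hsq hqt (hd q hqI) hq (γ P 1)
    exact (hrange r hr).1.trans_lt ((hrange r hr).2.lt_of_ne hne)
  have henergy r (hr : r ∈ Icc s t) : γ r 2 ^ 2 - γ r 1 ^ 3 - 2 * b * γ r 1 =
      - γ P 1 ^ 3 - 2 * b * γ P 1 := by
    have := h.energy_eq (hst hr) (hst hP)
    simp only [energy, hP0] at this
    linear_combination this
  have hb : γ p 1 ^ 2 + γ p 1 * γ P 1 + γ P 1 ^ 2 = -2 * b :=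
    mul_left_cancel₀ (sub_ne_zero.2 hlt.ne') (by linear_combination henergy p hp - γ p 2 * hp0)
  have hcubic r (hr : r ∈ Icc s t) :
      γ r 2 ^ 2 = (γ r 1 - γ p 1) * (γ r 1 - γ P 1) * (γ r 1 + γ p 1 + γ P 1) := by
    linear_combination henergy r hr + (γ r 1 - γ P 1) * hb
  have hle : γ p 1 + 2 * γ P 1 ≤ 0 := add_two_mul_nonpos_of_cubic_nonneg hlt fun u hu => by
    obtain ⟨r, hr, rfl⟩ := himage.symm ▸ hu
    exact (sq_nonneg (γ r 2)).trans_eq (hcubic r hr)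
  refine ⟨γ p 1, γ P 1, hlt, hle.lt_of_ne fun hzero => hq ?_, hb, (hrange s hsI).2, hcubic s hsI⟩
  exact h.velocity_eq_zero_of_equilibrium (hst hP) (hst hqI) hP0
    (by linear_combination (1 / 2) * hb - (1 / 2) * (γ p 1 - γ P 1) * hzero)

lemma IsTrajectory.exists_mem_ovalCylinder (h : IsTrajectory (normalField (3 / 2) b) γ I)
    (hb : b < 0) (hret : ReturnsForward γ I) :
    ∃ n r : ℝ, IsOval b n r ∧ ∃ s ∈ I, γ s ∈ ovalCylinder n r := by
  obtain ⟨t₀, ht₀⟩ := h.nonempty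
  have hI := h.Ici_subset (contDiff_normalField _ b) hret ht₀
  have hcont : ContinuousOn (fun t => γ t 2) (Ici t₀) := fun t ht =>
    ((continuousAt_pi.1 (h.continuousAt (hI ht))) 2).continuousWithinAt
  obtain ⟨hneg, hpos⟩ := not_or.1 (mt (h.tendsto_zero_of_velocity_signed hret)
    fun hzero => hb.ne hzero.1)
  obtain ⟨s, q, t, hs₀, hsq, hqt, hs, hq, ht⟩ := exists_zeros_of_frequently_sign hcont
    ((not_eventually.1 hneg).mono fun t => not_le.1)
    ((not_eventually.1 hpos).mono fun t => not_le.1)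
  obtain ⟨m, M, hmM, hlt, hb, hsM, hcubic⟩ := h.exists_roots
    (Icc_subset_Ici_self.trans ((Ici_subset_Ici.2 hs₀).trans hI)) hsq hqt hs ht hq
  refine ⟨-(m + M) / 2, (M - m) / 2, ⟨by linarith, by linarith, by linear_combination hb⟩,
    s, hI hs₀, ?_, by linarith⟩
  linear_combination hcubic

end Solutions

/-! ### The drift integral -/

section DriftIntegral

open intervalIntegral

lemma integral_comp_neg_cos (g : ℝ → ℝ) :
    ∫ θ in (0 : ℝ)..2 * Real.pi, g (-Real.cos θ) = ∫ θ in (0 : ℝ)..2 * Real.pi, g (Real.cos θ) := by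
  have hper : Function.Periodic (fun θ => g (Real.cos θ)) (2 * Real.pi) := fun θ => by
    simp only [Real.cos_add_two_pi]
  simp only [← Real.cos_add_pi]
  rw [integral_comp_add_right (fun θ => g (Real.cos θ)), zero_add, add_comm,
    hper.intervalIntegral_add_eq Real.pi 0, zero_add]

lemma integral_comp_cos_eq_two_mul {g : ℝ → ℝ} (hg : Continuous fun θ => g (Real.cos θ)) :
    ∫ θ in (0 : ℝ)..2 * Real.pi, g (Real.cos θ) = 2 * ∫ θ in (0 : ℝ)..Real.pi, g (Real.cos θ) := by
  have hhalf : ∫ θ in Real.pi..2 * Real.pi, g (Real.cos θ) =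
      ∫ θ in (0 : ℝ)..Real.pi, g (Real.cos θ) := by
    calc ∫ θ in Real.pi..2 * Real.pi, g (Real.cos θ)
        = ∫ θ in Real.pi..2 * Real.pi, g (Real.cos (2 * Real.pi - θ)) := by
          simp only [Real.cos_two_pi_sub]
      _ = ∫ θ in (0 : ℝ)..Real.pi, g (Real.cos θ) := by
          rw [integral_comp_sub_left (fun θ => g (Real.cos θ)), sub_self,
            show 2 * Real.pi - Real.pi = Real.pi by ring]
  rw [← integral_add_adjacent_intervals (hg.intervalIntegrable 0 Real.pi)
    (hg.intervalIntegrable _ _), hhalf, two_mul]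

lemma integral_inv_linear {c d l : ℝ} (hc : 0 < c) (hd : 0 < d) (hl : 0 ≤ l) :
    ∫ θ in (0 : ℝ)..l, (c + d * θ)⁻¹ = d⁻¹ * (Real.log (c + d * l) - Real.log c) := by
  have hcl : 0 < c + d * l := by positivity
  rw [integral_comp_add_mul (fun x => x⁻¹) hd.ne', mul_zero, add_zero,
    integral_inv_of_pos hc hcl, Real.log_div hcl.ne' hc.ne', smul_eq_mul]

/-- The function `s ↦ (1 + s) / √(3 + s)`, whose mean over `s = k cos θ` is the drift. -/
noncomputable def driftIntegrand (s : ℝ) : ℝ := (1 + s) / √(3 + s)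

/-- Up to a negative factor, the displacement of `x` over one turn of an oval of shape
`k = r / n`. The orbits on the cylinder over the oval are closed when it vanishes. -/
noncomputable def drift (k : ℝ) : ℝ := ∫ θ in (0 : ℝ)..2 * Real.pi, driftIntegrand (k * Real.cos θ)

section Integrand

variable {s t : ℝ}

lemma driftIntegrand_eq (hs : 0 < 3 + s) : driftIntegrand s = √(3 + s) - 2 / √(3 + s) := by
  have hpos := Real.sqrt_pos.2 hs
  rw [driftIntegrand, div_eq_iff hpos.ne', sub_mul, div_mul_cancel₀ _ hpos.ne',
    Real.mul_self_sqrt hs.le]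
  ring

lemma driftIntegrand_le {c d : ℝ} (hs : 0 < 3 + s) (hc : √(3 + s) ≤ c) (hd : √(3 + s) ≤ d) :
    driftIntegrand s ≤ c - 2 / d := by
  rw [driftIntegrand_eq hs]
  exact sub_le_sub hc (div_le_div_of_nonneg_left two_pos.le (Real.sqrt_pos.2 hs) hd)

lemma driftIntegrand_add_neg (hs : s ^ 2 < 9) : driftIntegrand s + driftIntegrand (-s) =
    √(6 + 2 * √(9 - s ^ 2)) - 2 * √(6 / √(9 - s ^ 2) ^ 2 + 2 / √(9 - s ^ 2)) := by
  obtain ⟨hs₁, hs₂⟩ : 0 < 3 + s ∧ 0 < 3 + -s := ⟨by nlinarith, by nlinarith⟩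
  rw [driftIntegrand_eq hs₁, driftIntegrand_eq hs₂]
  have hprod : √(9 - s ^ 2) = √(3 + s) * √(3 + -s) := by
    rw [← Real.sqrt_mul hs₁.le]
    ring_nf
  have hp := Real.sqrt_pos.2 hs₁
  have hq := Real.sqrt_pos.2 hs₂
  have hpq : √(3 + s) ^ 2 + √(3 + -s) ^ 2 = 6 := by
    rw [Real.sq_sqrt hs₁.le, Real.sq_sqrt hs₂.le]
    ring
  rw [hprod]
  generalize √(3 + s) = p at *
  generalize √(3 + -s) = q at *
  have hsum : √(6 + 2 * (p * q)) = p + q := by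
    rw [← hpq, ← Real.sqrt_sq (add_nonneg hp.le hq.le)]
    ring_nf
  have hquot : √(6 / (p * q) ^ 2 + 2 / (p * q)) = (p + q) / (p * q) := by
    rw [← hsum, ← Real.sqrt_sq (mul_pos hp hq).le, ← Real.sqrt_div' _ (sq_nonneg _),
      Real.sqrt_sq (mul_pos hp hq).le]
    congr 1
    field_simp
  rw [hsum, hquot]
  field_simp
  ring

lemma driftIntegrand_add_neg_lt (hst : s ^ 2 < t ^ 2) (ht : t ^ 2 < 9) :
    driftIntegrand t + driftIntegrand (-t) < driftIntegrand s + driftIntegrand (-s) := by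
  rw [driftIntegrand_add_neg ht, driftIntegrand_add_neg (hst.trans ht)]
  have hpos : 0 < √(9 - t ^ 2) := Real.sqrt_pos.2 (by linarith)
  have hlt : √(9 - t ^ 2) < √(9 - s ^ 2) := Real.sqrt_lt_sqrt (by linarith) (by linarith)
  generalize √(9 - t ^ 2) = x at *
  gcongr

end Integrand

section Drift

variable {k : ℝ}

lemma three_add_mul_cos_pos (hk : |k| < 3) (θ : ℝ) : 0 < 3 + k * Real.cos θ := by
  have hle : |k * Real.cos θ| ≤ |k| := by
    rw [abs_mul]
    exact mul_le_of_le_one_right (abs_nonneg k) (Real.abs_cos_le_one θ)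
  linarith [neg_abs_le (k * Real.cos θ)]

lemma continuous_driftIntegrand_mul_cos (hk : |k| < 3) :
    Continuous fun θ => driftIntegrand (k * Real.cos θ) :=
  Continuous.div (by fun_prop) (by fun_prop)
    fun θ => (Real.sqrt_pos.2 (three_add_mul_cos_pos hk θ)).ne'

lemma drift_neg (k : ℝ) : drift (-k) = drift k := by
  simpa only [drift, neg_mul, mul_neg] using
    integral_comp_neg_cos fun c => driftIntegrand (k * c)

lemma two_mul_drift (hk : |k| < 3) : 2 * drift k = ∫ θ in (0 : ℝ)..2 * Real.pi,
    (driftIntegrand (k * Real.cos θ) + driftIntegrand (-(k * Real.cos θ))) := by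
  have hneg : drift k = ∫ θ in (0 : ℝ)..2 * Real.pi, driftIntegrand (-(k * Real.cos θ)) := by
    rw [← drift_neg, drift]
    simp only [neg_mul]
  have hcont := continuous_driftIntegrand_mul_cos (k := -k) (by rwa [abs_neg])
  simp only [neg_mul] at hcont
  rw [integral_add ((continuous_driftIntegrand_mul_cos hk).intervalIntegrable _ _)
    (hcont.intervalIntegrable _ _), ← hneg, two_mul, drift]

lemma strictAntiOn_drift : StrictAntiOn drift (Ico 0 3) := by
  rintro k ⟨hk, hk3⟩ l ⟨hl, hl3⟩ hkl
  have hcont {m : ℝ} (hm : 0 ≤ m) (hm3 : m < 3) : Continuous fun θ =>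
      driftIntegrand (m * Real.cos θ) + driftIntegrand (-(m * Real.cos θ)) := by
    simp only [← neg_mul]
    exact (continuous_driftIntegrand_mul_cos (by rwa [abs_of_nonneg hm])).add
      (continuous_driftIntegrand_mul_cos (by rwa [abs_neg, abs_of_nonneg hm]))
  have hsq : k ^ 2 < l ^ 2 := pow_lt_pow_left₀ hkl hk two_ne_zero
  have hl9 : l ^ 2 < 9 := by nlinarith
  suffices 2 * drift l < 2 * drift k from lt_of_mul_lt_mul_left this two_pos.le
  rw [two_mul_drift (by rwa [abs_of_nonneg hl]), two_mul_drift (by rwa [abs_of_nonneg hk])]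
  refine integral_lt_integral_of_continuousOn_of_le_of_exists_lt Real.two_pi_pos
    (hcont hl hl3).continuousOn (hcont hk hk3).continuousOn (fun θ _ => ?_)
    ⟨0, left_mem_Icc.2 Real.two_pi_pos.le, ?_⟩
  · rcases eq_or_ne (Real.cos θ) 0 with hcos | hcos
    · rw [hcos, mul_zero, mul_zero]
    · refine (driftIntegrand_add_neg_lt ?_ ?_).le
      · rw [mul_pow, mul_pow]
        exact mul_lt_mul_of_pos_right hsq (by positivity)
      · rw [mul_pow]
        nlinarith [Real.cos_sq_le_one θ]
  · rw [Real.cos_zero, mul_one, mul_one]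
    exact driftIntegrand_add_neg_lt hsq hl9

lemma continuousOn_drift {l : ℝ} (hl : l < 3) : ContinuousOn drift (Icc 0 l) := by
  have habs (k : ℝ) : |max 0 (min k l)| < 3 := by
    rw [abs_of_nonneg (le_max_left _ _)]
    exact max_lt three_pos ((min_le_right k l).trans_lt hl)
  have hcont : Continuous fun k => drift (max 0 (min k l)) := by
    refine continuous_parametric_intervalIntegral_of_continuous' ?_ _ _
    exact Continuous.div (by fun_prop) (by fun_prop) fun p =>
      (Real.sqrt_pos.2 (three_add_mul_cos_pos (habs p.1) p.2)).ne'
  refine hcont.continuousOn.congr fun k hk => ?_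
  simp only [min_eq_left hk.2, max_eq_right hk.1]

lemma drift_zero_pos : 0 < drift 0 := by
  simp only [drift, driftIntegrand, zero_mul, add_zero, integral_const, smul_eq_mul, sub_zero]
  positivity

lemma sqrt_three_sub_mul_cos_le {δ θ : ℝ} (hδ : 0 ≤ δ) (hδ3 : δ ^ 2 ≤ 3) (hθ : 0 ≤ θ) :
    √(3 - (3 - δ ^ 2) * Real.cos θ) ≤ δ + 5 / 4 * θ := by
  rw [Real.sqrt_le_left (by positivity)]
  have hcos := mul_le_mul_of_nonneg_left (Real.one_sub_sq_div_two_le_cos (x := θ))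
    (sub_nonneg.2 hδ3)
  nlinarith [mul_nonneg hδ hθ, mul_nonneg (sq_nonneg δ) (sq_nonneg θ), sq_nonneg θ]

/-- As `k → 3` the integrand tends to that of a logarithmically divergent integral at `θ = π`, so
the drift tends to `-∞`. -/
lemma drift_three_sub_sq_le {δ : ℝ} (hδ : 0 < δ) (hδ3 : δ ^ 2 < 3) :
    drift (3 - δ ^ 2) ≤
      2 * (Real.pi * √6 - 8 / 5 * (Real.log (δ + 5 / 4 * Real.pi) - Real.log δ)) := by
  have hk : |-(3 - δ ^ 2)| < 3 := by
    rw [abs_neg, abs_of_pos (sub_pos.2 hδ3)]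
    exact sub_lt_self 3 (by positivity)
  have hpos {θ : ℝ} (hθ : θ ∈ uIcc 0 Real.pi) : 0 < δ + 5 / 4 * θ := by
    rw [uIcc_of_le Real.pi_pos.le] at hθ
    linarith [hθ.1]
  have hinv : IntervalIntegrable (fun θ => 2 * (δ + 5 / 4 * θ)⁻¹) MeasureTheory.volume 0 Real.pi :=
    ContinuousOn.intervalIntegrable (continuousOn_const.mul
      (ContinuousOn.inv₀ (by fun_prop) fun θ hθ => (hpos hθ).ne'))
  have hcont := continuous_driftIntegrand_mul_cos hk
  rw [← drift_neg, drift,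
    integral_comp_cos_eq_two_mul (g := fun c => driftIntegrand (-(3 - δ ^ 2) * c)) hcont]
  refine mul_le_mul_of_nonneg_left ?_ two_pos.le
  calc ∫ θ in (0 : ℝ)..Real.pi, driftIntegrand (-(3 - δ ^ 2) * Real.cos θ)
      ≤ ∫ θ in (0 : ℝ)..Real.pi, (√6 - 2 * (δ + 5 / 4 * θ)⁻¹) := by
        refine integral_mono_on Real.pi_pos.le (hcont.intervalIntegrable _ _)
          (intervalIntegrable_const.sub hinv) fun θ hθ => ?_
        rw [← div_eq_mul_inv]
        refine driftIntegrand_le (three_add_mul_cos_pos hk θ) (Real.sqrt_le_sqrt ?_) ?_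
        · nlinarith [Real.neg_one_le_cos θ]
        · rw [neg_mul, ← sub_eq_add_neg]
          exact sqrt_three_sub_mul_cos_le hδ.le hδ3.le hθ.1
    _ = Real.pi * √6 - 8 / 5 * (Real.log (δ + 5 / 4 * Real.pi) - Real.log δ) := by
        rw [integral_sub intervalIntegrable_const hinv, integral_const, integral_const_mul,
          integral_inv_linear hδ (by norm_num) Real.pi_pos.le, sub_zero, smul_eq_mul]
        ring

lemma drift_three_sub_exp_neg_ten_lt_zero : drift (3 - Real.exp (-10)) < 0 := by
  have hexp : Real.exp (-10) = Real.exp (-5) ^ 2 := by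
    rw [← Real.exp_nat_mul]
    norm_num
  have hδ : Real.exp (-5) < 1 := Real.exp_lt_one_iff.2 (by norm_num)
  have hle := drift_three_sub_sq_le (Real.exp_pos (-5)) (by nlinarith [Real.exp_pos (-5)])
  have hlog : 0 ≤ Real.log (Real.exp (-5) + 5 / 4 * Real.pi) :=
    Real.log_nonneg (by linarith [Real.exp_pos (-5), Real.pi_gt_three])
  have hsqrt : √6 < 2.45 := by
    rw [Real.sqrt_lt' (by norm_num)]
    norm_num
  rw [Real.log_exp] at hle
  rw [hexp]
  nlinarith [Real.pi_lt_d2, Real.sqrt_nonneg 6]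

lemma existsUnique_drift_eq_zero : ∃! k, k ∈ Ioo 0 3 ∧ drift k = 0 := by
  have hexp : Real.exp (-10) < 1 := Real.exp_lt_one_iff.2 (by norm_num)
  obtain ⟨k, hk, hk0⟩ : (0 : ℝ) ∈ drift '' Icc 0 (3 - Real.exp (-10)) :=
    intermediate_value_Icc' (by linarith)
      (continuousOn_drift (sub_lt_self 3 (Real.exp_pos (-10))))
      ⟨drift_three_sub_exp_neg_ten_lt_zero.le, drift_zero_pos.le⟩
  have hk3 : k < 3 := hk.2.trans_lt (sub_lt_self 3 (Real.exp_pos (-10)))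
  refine ⟨k, ⟨⟨hk.1.lt_of_ne' ?_, hk3⟩, hk0⟩, ?_⟩
  · rintro rfl
    exact drift_zero_pos.ne' hk0
  · rintro l ⟨hl, hl0⟩
    exact strictAntiOn_drift.injOn ⟨hl.1.le, hl.2⟩ ⟨hk.1, hk3⟩ (hl0.trans hk0.symm)

end Drift

end DriftIntegral

/-! ### Geometry of the oval cylinders -/

lemma mk_mem_unitSphere {c s : ℝ} (hcs : c ^ 2 + s ^ 2 = 1) :
    (⟨c, s⟩ : ℂ) ∈ Submonoid.unitSphere ℂ :=
  mem_sphere_zero_iff_norm.2 (by rw [Complex.norm_eq_sqrt_sq_add_sq, hcs, Real.sqrt_one])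

lemma re_sq_add_im_sq (z : Circle) : (z : ℂ).re ^ 2 + (z : ℂ).im ^ 2 = 1 := by
  rw [sq, sq, ← Complex.normSq_apply, z.normSq_coe]

/-- The parametrization of the oval cylinder by `x` and a point `(c, s)` of the unit circle. -/
noncomputable def ovalPoint (n r x c s : ℝ) : Space := ![x, -n - r * c, r * s * √(3 * n + r * c)]

/-- The inverse of `ovalPoint`: the point of the unit circle with the parameters of `p`. -/
noncomputable def ovalAngle (n r : ℝ) (p : Space) : ℂ :=
  ⟨(-n - p 1) / r, p 2 / (r * √(2 * n - p 1))⟩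

section Cylinder

variable {b n r x c s : ℝ} {p : Space}

lemma IsOval.three_mul_add_mul_pos (h : IsOval b n r) (hcs : c ^ 2 + s ^ 2 = 1) :
    0 < 3 * n + r * c := by
  have hc : -1 ≤ c := (abs_le_of_sq_le_sq' (by nlinarith [sq_nonneg s]) zero_le_one).1
  nlinarith [h.pos, h.lt]

lemma ovalPoint_mem_ovalCylinder (h : IsOval b n r) (hcs : c ^ 2 + s ^ 2 = 1) :
    ovalPoint n r x c s ∈ ovalCylinder n r := by
  have hpos := h.three_mul_add_mul_pos hcs
  refine ⟨?_, by simp only [ovalPoint, Matrix.cons_val_one, Matrix.cons_val_zero]; linarith⟩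
  simp only [ovalPoint, Matrix.cons_val_one, Matrix.cons_val_zero, Matrix.cons_val]
  rw [mul_pow, Real.sq_sqrt hpos.le]
  linear_combination r ^ 2 * (3 * n + r * c) * hcs

lemma ovalAngle_mem_unitSphere (hr : 0 < r) (hp : p ∈ ovalCylinder n r) :
    ovalAngle n r p ∈ Submonoid.unitSphere ℂ := by
  have hpos : 0 < 2 * n - p 1 := sub_pos.2 hp.2
  refine mk_mem_unitSphere ?_
  rw [div_pow, div_pow, mul_pow, Real.sq_sqrt hpos.le, hp.1, mul_div_mul_right _ _ hpos.ne']
  field_simp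
  ring

lemma ovalPoint_ovalAngle (hr : 0 < r) (hp : p ∈ ovalCylinder n r) :
    ovalPoint n r (p 0) (ovalAngle n r p).re (ovalAngle n r p).im = p := by
  have hsqrt : 0 < √(2 * n - p 1) := Real.sqrt_pos.2 (sub_pos.2 hp.2)
  have hu : -n - r * ((-n - p 1) / r) = p 1 := by rw [mul_div_cancel₀ _ hr.ne', sub_sub_cancel]
  have hv : r * (p 2 / (r * √(2 * n - p 1))) * √(3 * n + r * ((-n - p 1) / r)) = p 2 := by
    rw [mul_div_cancel₀ _ hr.ne', show 3 * n + (-n - p 1) = 2 * n - p 1 by ring]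
    field_simp
  ext i
  fin_cases i
  exacts [rfl, hu, hv]

lemma ovalAngle_ovalPoint (h : IsOval b n r) (x : ℝ) (hcs : c ^ 2 + s ^ 2 = 1) :
    ovalAngle n r (ovalPoint n r x c s) = ⟨c, s⟩ := by
  have hr := h.pos
  have hsqrt := Real.sqrt_pos.2 (h.three_mul_add_mul_pos hcs)
  simp only [ovalAngle, ovalPoint, Matrix.cons_val_one, Matrix.cons_val_zero, Matrix.cons_val]
  rw [sub_sub_cancel, mul_div_cancel_left₀ _ hr.ne',
    show 2 * n - (-n - r * c) = 3 * n + r * c by ring]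
  congr 1
  field_simp

lemma continuousOn_ovalAngle (hr : 0 < r) : ContinuousOn (ovalAngle n r) (ovalCylinder n r) := by
  have heq : ovalAngle n r = fun p => (((-n - p 1) / r : ℝ) : ℂ) +
      ((p 2 / (r * √(2 * n - p 1)) : ℝ) : ℂ) * Complex.I :=
    funext fun p => Complex.mk_eq_add_mul_I _ _
  rw [heq]
  have hsin : ContinuousOn (fun p : Space => p 2 / (r * √(2 * n - p 1))) (ovalCylinder n r) :=
    ContinuousOn.div (by fun_prop) (by fun_prop) fun p hp =>
      (mul_pos hr (Real.sqrt_pos.2 (sub_pos.2 hp.2))).ne'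
  fun_prop

/-- The homeomorphism `ovalAngle` from the oval cylinder to `ℝ × 𝕊¹`. -/
noncomputable def ovalHomeomorph (h : IsOval b n r) : ovalCylinder n r ≃ₜ ℝ × Circle where
  toFun p := (p.1 0, ⟨ovalAngle n r p, ovalAngle_mem_unitSphere h.pos p.2⟩)
  invFun q := ⟨ovalPoint n r q.1 (q.2 : ℂ).re (q.2 : ℂ).im,
    ovalPoint_mem_ovalCylinder h (re_sq_add_im_sq q.2)⟩
  left_inv p := Subtype.ext (ovalPoint_ovalAngle h.pos p.2)
  right_inv q := Prod.ext rfl (Subtype.ext (ovalAngle_ovalPoint h q.1 (re_sq_add_im_sq q.2)))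
  continuous_toFun := ((continuous_apply 0).comp continuous_subtype_val).prodMk
    ((continuousOn_iff_continuous_domRestrict.1 (continuousOn_ovalAngle h.pos)).subtype_mk _)
  continuous_invFun := by
    have hre : Continuous fun q : ℝ × Circle => (q.2 : ℂ).re := by fun_prop
    have him : Continuous fun q : ℝ × Circle => (q.2 : ℂ).im := by fun_prop
    refine (continuous_pi fun i => ?_).subtype_mk _
    fin_cases i
    exacts [continuous_fst, continuous_const.sub (hre.const_mul r),
      (him.const_mul r).mul ((hre.const_mul r).const_add (3 * n)).sqrt]

lemma isPreconnected_ovalCylinder (h : IsOval b n r) : IsPreconnected (ovalCylinder n r) := by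
  have : ConnectedSpace Circle := Circle.exp_surjective.connectedSpace Circle.exp.continuous
  have : ConnectedSpace (ovalCylinder n r) :=
    (ovalHomeomorph h).symm.surjective.connectedSpace (ovalHomeomorph h).symm.continuous
  exact isPreconnected_iff_preconnectedSpace.2 inferInstance

lemma hasFDerivAt_energy (a b : ℝ) (p : Space) :
    HasFDerivAt (energy a b) ((2 * p 2) • ContinuousLinearMap.proj (R := ℝ) (φ := fun _ => ℝ) 2 -
      (2 * (a * p 1 ^ 2 + b)) • ContinuousLinearMap.proj (R := ℝ) (φ := fun _ => ℝ) 1) p := by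
  have hu := hasFDerivAt_apply (𝕜 := ℝ) (F' := fun _ : Fin 3 => ℝ) 1 p
  have hv := hasFDerivAt_apply (𝕜 := ℝ) (F' := fun _ : Fin 3 => ℝ) 2 p
  refine (((hv.pow 2).sub ((hu.pow 3).const_mul (2 * a / 3))).sub
    (hu.const_mul (2 * b))).congr_fderiv ?_
  ext w
  simp
  ring

lemma contDiff_energy (a b : ℝ) {m : WithTop ℕ∞} : ContDiff ℝ m (energy a b) := by
  unfold energy
  fun_prop

lemma eq_zero_of_fderiv_energy_eq_zero {a b : ℝ} (hp : fderiv ℝ (energy a b) p = 0) :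
    p 2 = 0 ∧ a * p 1 ^ 2 + b = 0 := by
  rw [(hasFDerivAt_energy a b p).fderiv] at hp
  exact ⟨by simpa using DFunLike.congr_fun hp (Pi.single 2 1),
    by simpa using DFunLike.congr_fun hp (Pi.single 1 1)⟩

lemma mem_ovalCylinder_iff (h : IsOval b n r) :
    p ∈ ovalCylinder n r ↔ energy (3 / 2) b p = 2 * n * (r ^ 2 - n ^ 2) ∧ p 1 < 2 * n := by
  refine and_congr_left fun _ => ⟨fun hp => ?_, fun hp => ?_⟩
  · rw [energy]
    linear_combination hp - p 1 * h.eq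
  · rw [energy] at hp
    linear_combination hp + p 1 * h.eq

lemma add_le_of_mem_ovalCylinder (hr : 0 < r) (hp : p ∈ ovalCylinder n r) : p 1 + n ≤ r := by
  obtain ⟨heq, hlt⟩ := hp
  by_contra! hcon
  have : 0 < ((p 1 + n) ^ 2 - r ^ 2) * (2 * n - p 1) := mul_pos (by nlinarith) (by linarith)
  nlinarith [sq_nonneg (p 2)]

lemma fderiv_energy_ne_zero (h : IsOval b n r) (hp : p ∈ ovalCylinder n r) :
    fderiv ℝ (energy (3 / 2) b) p ≠ 0 := by
  intro hzero
  obtain ⟨hv, hforcing⟩ := eq_zero_of_fderiv_energy_eq_zero hzero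
  obtain ⟨heq, hlt⟩ := hp
  have hend : r ^ 2 - (p 1 + n) ^ 2 = 0 := by
    refine (mul_eq_zero.1 ?_).resolve_right (sub_pos.2 hlt).ne'
    rw [← heq, hv, sq, mul_zero]
  have hval : 3 * n * (p 1 + n) = r ^ 2 := by
    linear_combination (-3 / 2) * hend - hforcing + (1 / 2) * h.eq
  have hprod : r ^ 2 * (9 * n ^ 2 - r ^ 2) = 0 := by
    linear_combination 9 * n ^ 2 * hend + (3 * n * (p 1 + n) + r ^ 2) * hval
  exact (mul_pos (pow_pos h.pos 2) (by nlinarith [h.pos, h.lt])).ne' hprod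

lemma isClosed_ovalCylinder (h : IsOval b n r) : IsClosed (ovalCylinder n r) := by
  have heq : ovalCylinder n r =
      {p | energy (3 / 2) b p = 2 * n * (r ^ 2 - n ^ 2)} ∩ {p | p 1 + n ≤ r} := by
    ext p
    refine ⟨fun hp => ⟨((mem_ovalCylinder_iff h).1 hp).1, add_le_of_mem_ovalCylinder h.pos hp⟩,
      fun hp => (mem_ovalCylinder_iff h).2 ⟨hp.1, ?_⟩⟩
    linarith [h.lt, mem_ofPred.1 hp.2]
  rw [heq]
  exact (isClosed_eq (contDiff_energy _ b (m := 0)).continuous continuous_const).inter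
    (isClosed_le (by fun_prop) continuous_const)

lemma isRegularSurface_ovalCylinder (h : IsOval b n r) : IsRegularSurface (ovalCylinder n r) := by
  refine ⟨⟨ovalPoint n r 0 1 0, ovalPoint_mem_ovalCylinder h (by norm_num)⟩,
    isClosed_ovalCylinder h, fun p hp => ?_⟩
  have hcont := (contDiff_energy (3 / 2) b (m := 1)).continuous_fderiv one_ne_zero
  refine ⟨{q | q 1 < 2 * n} ∩ {q | fderiv ℝ (energy (3 / 2) b) q ≠ 0},
    (isOpen_lt (by fun_prop) continuous_const).inter (isOpen_ne_fun hcont continuous_const),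
    ⟨hp.2, fderiv_energy_ne_zero h hp⟩, fun q => energy (3 / 2) b q - 2 * n * (r ^ 2 - n ^ 2),
    ((contDiff_energy _ b).sub contDiff_const).contDiffOn, fun q hq => ?_, ?_⟩
  · rw [fderiv_sub_const]
    exact hq.2
  · ext q
    refine ⟨fun hq => ⟨hq.2, sub_eq_zero.2 ((mem_ovalCylinder_iff h).1 hq.1).1⟩, fun hq =>
      ⟨(mem_ovalCylinder_iff h).2 ⟨sub_eq_zero.1 hq.2, hq.1.1⟩, hq.1⟩⟩

end Cylinder

/-! ### Explicit solutions on the oval cylinders -/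

lemma surjective_of_map_add {f : ℝ → ℝ} {P T : ℝ} (hf : Continuous f) (hmono : Monotone f)
    (hT : 0 < T) (hadd : ∀ t, f (t + P) = f t + T) : Function.Surjective f := by
  let F : AddConstMap ℝ ℝ P T := ⟨f, hadd⟩
  refine hf.surjective (tendsto_atTop_atTop_of_monotone hmono fun y => ?_)
    (tendsto_atBot_atBot_of_monotone hmono fun y => ?_)
  · obtain ⟨k, hk⟩ := Archimedean.arch (y - f 0) hT
    have hF : f (k • P) = f 0 + k • T := AddConstMapClass.map_nsmul_const F k
    exact ⟨k • P, by linarith⟩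
  · obtain ⟨k, hk⟩ := Archimedean.arch (f 0 - y) hT
    have hF : f (0 - k • P) = f 0 - k • T := AddConstMapClass.map_sub_nsmul F 0 k
    exact ⟨0 - k • P, by linarith⟩

lemma exists_orderIso_hasDerivAt {w : ℝ → ℝ} {P : ℝ} (hw : Continuous w) (hpos : ∀ θ, 0 < w θ)
    (hper : Function.Periodic w P) (hP : 0 < P) :
    ∃ (Θ : ℝ ≃o ℝ) (T : ℝ), Θ 0 = 0 ∧ 0 < T ∧ (∀ t, HasDerivAt Θ (w (Θ t)) t) ∧
      ∀ t, Θ (t + T) = Θ t + P := by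
  obtain ⟨g, hg0, hg, hgP⟩ := exists_primitive_periodic (f := fun θ => (w θ)⁻¹)
    (hw.inv₀ fun θ => (hpos θ).ne') fun θ => congrArg (·⁻¹) (hper θ)
  have hmono : StrictMono g := strictMono_of_hasDerivAt_pos hg fun θ => inv_pos.2 (hpos θ)
  have hT : 0 < ∫ θ in (0 : ℝ)..P, (w θ)⁻¹ := by
    have hlt := hmono (lt_add_of_pos_right 0 hP)
    rwa [hgP, lt_add_iff_pos_right] at hlt
  have hcont : Continuous g := continuous_iff_continuousAt.2 fun θ => (hg θ).continuousAt
  let e := hmono.orderIsoOfSurjective g (surjective_of_map_add hcont hmono.monotone hT hgP)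
  have he t : g (e.symm t) = t := e.apply_symm_apply t
  refine ⟨e.symm, _, hmono.injective (by rw [he, hg0]), hT, fun t => ?_, fun t =>
    hmono.injective (by rw [he, hgP, he])⟩
  simpa only [inv_inv] using HasDerivAt.of_local_left_inverse e.symm.continuous.continuousAt
    (hg (e.symm t)) (inv_pos.2 (hpos _)).ne' (Eventually.of_forall he)

section Oval

variable {b n r : ℝ} {γ : ℝ → Space} {I : Set ℝ}

lemma IsOval.three_mul_add_mul_cos_pos (h : IsOval b n r) (θ : ℝ) :
    0 < 3 * n + r * Real.cos θ :=
  h.three_mul_add_mul_pos (Real.cos_sq_add_sin_sq θ)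

lemma exists_eq_ovalPoint (hr : 0 < r) {p : Space} (hp : p ∈ ovalCylinder n r) :
    ∃ θ, p = ovalPoint n r (p 0) (Real.cos θ) (Real.sin θ) := by
  obtain ⟨θ, hθ⟩ := Circle.exp_surjective ⟨ovalAngle n r p, ovalAngle_mem_unitSphere hr hp⟩
  have hexp : Complex.exp (θ * Complex.I) = ovalAngle n r p := congrArg Subtype.val hθ
  refine ⟨θ, ?_⟩
  rw [← Complex.exp_ofReal_mul_I_re, ← Complex.exp_ofReal_mul_I_im, hexp,
    ovalPoint_ovalAngle hr hp]

lemma hasDerivAt_ovalPoint (h : IsOval b n r) {X Θ : ℝ → ℝ} {t : ℝ}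
    (hX : HasDerivAt X (-n - r * Real.cos (Θ t)) t)
    (hΘ : HasDerivAt Θ √(3 * n + r * Real.cos (Θ t)) t) :
    HasDerivAt (fun t => ovalPoint n r (X t) (Real.cos (Θ t)) (Real.sin (Θ t)))
      (normalField (3 / 2) b (ovalPoint n r (X t) (Real.cos (Θ t)) (Real.sin (Θ t)))) t := by
  have hpos := h.three_mul_add_mul_cos_pos (Θ t)
  have hsq := Real.sq_sqrt hpos.le
  have hsqrt := Real.sqrt_pos.2 hpos
  rw [hasDerivAt_normalField_iff]
  refine ⟨hX, ((hΘ.cos.const_mul r).const_sub (-n)).congr_deriv ?_,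
    ((hΘ.sin.const_mul r).mul
      (((hΘ.cos.const_mul r).const_add (3 * n)).sqrt hpos.ne')).congr_deriv ?_⟩
  · simp only [ovalPoint, Matrix.cons_val]
    ring
  · simp only [ovalPoint, Matrix.cons_val_one, Matrix.cons_val_zero]
    generalize √(3 * n + r * Real.cos (Θ t)) = w at *
    field_simp
    linear_combination 2 * r * Real.cos (Θ t) * hsq - r ^ 2 * Real.sin_sq_add_cos_sq (Θ t) - h.eq

lemma integral_velocity_eq (h : IsOval b n r) :
    ∫ θ in (0 : ℝ)..2 * Real.pi, (-n - r * Real.cos θ) / √(3 * n + r * Real.cos θ) =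
      -√n * drift (r / n) := by
  have hn : 0 < n := by linarith [h.pos, h.lt]
  rw [drift, ← intervalIntegral.integral_const_mul]
  refine intervalIntegral.integral_congr fun θ _ => ?_
  have hscale : 3 * n + r * Real.cos θ = n * (3 + r / n * Real.cos θ) := by field_simp
  have hpos : 0 < 3 + r / n * Real.cos θ :=
    (mul_pos_iff_of_pos_left hn).1 (hscale ▸ h.three_mul_add_mul_cos_pos θ)
  have hsqrt := Real.sqrt_pos.2 hpos
  simp only [driftIntegrand]
  rw [hscale, Real.sqrt_mul hn.le, ← mul_div_assoc, div_eq_div_iff (by positivity) hsqrt.ne']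
  field_simp
  rw [Real.sq_sqrt hn.le]
  ring

lemma exists_oval_solutions (h : IsOval b n r) :
    ∃ T, 0 < T ∧ ∀ p ∈ ovalCylinder n r, ∃ γ : ℝ → Space, γ 0 = p ∧
      (∀ t, HasDerivAt γ (normalField (3 / 2) b (γ t)) t) ∧ (∀ t, γ t ∈ ovalCylinder n r) ∧
      (∀ t, γ (t + T) = ![γ t 0 + -√n * drift (r / n), γ t 1, γ t 2]) ∧
      ∀ s, 0 < s → s < T → ¬ Function.Periodic γ s := by
  have hpos θ := Real.sqrt_pos.2 (h.three_mul_add_mul_cos_pos θ)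
  obtain ⟨Θ, T, hΘ0, hT, hΘ, hΘT⟩ := exists_orderIso_hasDerivAt
    (w := fun θ => √(3 * n + r * Real.cos θ)) (by fun_prop) hpos
    (fun θ => by simp only [Real.cos_add_two_pi]) Real.two_pi_pos
  obtain ⟨X, -, hX, hXT⟩ := exists_primitive_periodic (T := 2 * Real.pi)
    (f := fun θ => (-n - r * Real.cos θ) / √(3 * n + r * Real.cos θ))
    (Continuous.div (by fun_prop) (by fun_prop) fun θ => (hpos θ).ne')
    (fun θ => by simp only [Real.cos_add_two_pi])
  rw [integral_velocity_eq h] at hXT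
  refine ⟨T, hT, fun p hp => ?_⟩
  obtain ⟨θ₀, hθ₀⟩ := exists_eq_ovalPoint h.pos hp
  obtain ⟨t₀, rfl⟩ := Θ.surjective θ₀
  refine ⟨fun t => ovalPoint n r (p 0 - X (Θ t₀) + X (Θ (t + t₀))) (Real.cos (Θ (t + t₀)))
    (Real.sin (Θ (t + t₀))), by simpa only [zero_add, sub_add_cancel] using hθ₀.symm, fun t => ?_,
    fun t => ovalPoint_mem_ovalCylinder h (Real.cos_sq_add_sin_sq _), fun t => ?_,
    fun s hs hsT hper => ?_⟩
  · have hθ : HasDerivAt (fun t => Θ (t + t₀)) √(3 * n + r * Real.cos (Θ (t + t₀))) t :=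
      (hΘ (t + t₀)).comp_add_const t t₀
    refine hasDerivAt_ovalPoint h ((((hX _).comp t hθ).const_add _).congr_deriv ?_) hθ
    exact div_mul_cancel₀ _ (hpos _).ne'
  · simp only [add_right_comm t T t₀, hΘT, hXT, Real.cos_add_two_pi, Real.sin_add_two_pi,
      ← add_assoc]
    rfl
  · have hu := congrFun (hper (-t₀)) 1
    simp only [ovalPoint, Matrix.cons_val_one, Matrix.cons_val_zero, neg_add_cancel, hΘ0,
      Real.cos_zero, neg_add_cancel_comm] at hu
    have hcos : Real.cos (Θ s) = 1 := mul_left_cancel₀ h.pos.ne' (by linarith)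
    have hpos : 0 < Θ s := hΘ0 ▸ Θ.strictMono hs
    have hΘT0 : Θ T = 2 * Real.pi := by simpa only [zero_add, hΘ0] using hΘT 0
    have hlt : Θ s < 2 * Real.pi := hΘT0 ▸ Θ.strictMono hsT
    exact hpos.ne' ((Real.cos_eq_one_iff_of_lt_of_lt (by linarith) hlt).1 hcos)

end Oval

/-! ### The closed oval cylinder -/

/-- The parameters of the oval cylinders on which the drift vanishes, so that the orbits close up
and are periodic. -/
structure IsClosedOval (b n r : ℝ) : Prop extends IsOval b n r where
  drift_eq_zero : drift (r / n) = 0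

lemma IsOval.pos_left {b n r : ℝ} (h : IsOval b n r) : 0 < n := by
  linarith [h.pos, h.lt]

lemma exists_isClosedOval_forall_eq {b : ℝ} (hb : b < 0) :
    ∃ n r, IsClosedOval b n r ∧ ∀ n' r', IsClosedOval b n' r' → n' = n ∧ r' = r := by
  obtain ⟨k, ⟨⟨hk0, hk3⟩, hk⟩, huniq⟩ := existsUnique_drift_eq_zero
  have hq : 0 < -2 * b / (3 + k ^ 2) := div_pos (by linarith) (by positivity)
  set n := √(-2 * b / (3 + k ^ 2))
  have hn : 0 < n := Real.sqrt_pos.2 hq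
  have hn2 : n ^ 2 * (3 + k ^ 2) = -2 * b := by
    rw [Real.sq_sqrt hq.le, div_mul_cancel₀ _ (by positivity)]
  refine ⟨n, k * n, ⟨⟨by positivity, mul_lt_mul_of_pos_right hk3 hn, by linear_combination hn2⟩,
    by rwa [mul_div_cancel_right₀ _ hn.ne']⟩, fun n' r' h => ?_⟩
  have hn' := h.pos_left
  have hr' : r' = k * n' := by
    rw [← huniq _ ⟨⟨div_pos h.pos hn', (div_lt_iff₀ hn').2 h.lt⟩, h.drift_eq_zero⟩,
      div_mul_cancel₀ _ hn'.ne']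
  have hsq : n' ^ 2 = n ^ 2 := mul_right_cancel₀ (b := 3 + k ^ 2) (by positivity) <| by
    rw [hn2, ← h.eq, hr']
    ring
  have hnn : n' = n := (pow_left_inj₀ hn'.le hn.le two_ne_zero).1 hsq
  exact ⟨hnn, hnn ▸ hr'⟩

section Returning

variable {b n r : ℝ} {γ : ℝ → Space} {I : Set ℝ}

lemma IsTrajectory.exists_mem_ovalCylinder_of_isClosedOval
    (h : IsTrajectory (normalField (3 / 2) b) γ I) (hb : b < 0) (hret : ReturnsForward γ I) :
    ∃ n r, IsClosedOval b n r ∧ ∀ t ∈ I, γ t ∈ ovalCylinder n r := by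
  obtain ⟨n, r, hnr, s, hs, hsm⟩ := h.exists_mem_ovalCylinder hb hret
  obtain ⟨T, hT, hsol⟩ := exists_oval_solutions hnr
  obtain ⟨δ, hδ0, hδ, hδm, hδT, -⟩ := hsol _ hsm
  have heq : EqOn γ (fun t => δ (t - s)) I :=
    h.toIsSolutionOn.eqOn (contDiff_normalField _ _) ⟨h.isOpen, h.ordConnected, h.nonempty,
      fun t _ => (hδ (t - s)).comp_sub_const t s⟩ hs (by simp only [sub_self, hδ0])
  have hI : ∀ᶠ t in atTop, t ∈ I := h.eventually_mem (contDiff_normalField _ _) hret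
  obtain ⟨C, hC⟩ := hret.frequently_abs_le hI
  have hcont : Continuous δ := continuous_iff_continuousAt.2 fun t => (hδ t).continuousAt
  have hdrift : -√n * drift (r / n) = 0 :=
    eq_zero_of_frequently_of_translation (f := fun t => δ (t - s) 0) (C := C) (by fun_prop) hT
      (fun t => by rw [add_sub_right_comm, hδT, Matrix.cons_val_zero])
      (((hC 0).and_eventually hI).mono fun t ht => by simpa only [← heq ht.2] using ht.1)
  refine ⟨n, r, ⟨hnr, (mul_eq_zero.1 hdrift).resolve_left ?_⟩, fun t ht => heq ht ▸ hδm _⟩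
  exact neg_ne_zero.2 (Real.sqrt_pos.2 hnr.pos_left).ne'

end Returning

lemma IsClosedOval.exists_isPeriodicOrbit {b n r : ℝ} (h : IsClosedOval b n r) :
    ∃ T, ∀ p ∈ ovalCylinder n r, ∃ γ, IsPeriodicOrbit (normalField (3 / 2) b) γ T ∧ γ 0 = p ∧
      range γ ⊆ ovalCylinder n r := by
  obtain ⟨T, hT, hsol⟩ := exists_oval_solutions h.toIsOval
  refine ⟨T, fun p hp => ?_⟩
  obtain ⟨γ, hγ0, hγ, hγm, hγT, hmin⟩ := hsol p hp
  refine ⟨γ, ⟨hγ, hT, fun t => ?_, hmin⟩, hγ0, range_subset_iff.2 hγm⟩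
  rw [hγT, h.drift_eq_zero, mul_zero, add_zero]
  ext i
  fin_cases i <;> rfl

/-! ### A regular surface inside another one is open in it -/

section Normed

variable {E : Type*} [NormedAddCommGroup E] [NormedSpace ℝ E] {g ψ : E → ℝ} {L M : E →L[ℝ] ℝ}
  {p w : E}

lemma exists_pos_apply_and_apply_ne_zero (hL : L ≠ 0) (hM : M ≠ 0) : ∃ w, 0 < L w ∧ M w ≠ 0 := by
  suffices ∃ w, L w ≠ 0 ∧ M w ≠ 0 by
    obtain ⟨w, hLw, hMw⟩ := this
    rcases lt_or_gt_of_ne hLw with h | h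
    · exact ⟨-w, by rwa [map_neg, neg_pos], by rwa [map_neg, neg_ne_zero]⟩
    · exact ⟨w, h, hMw⟩
  obtain ⟨u, hu⟩ := DFunLike.ne_iff.1 hL
  obtain ⟨v, hv⟩ := DFunLike.ne_iff.1 hM
  by_cases hMu : M u = 0
  · by_cases hLv : L v = 0
    · exact ⟨u + v, by rwa [map_add, hLv, add_zero], by rwa [map_add, hMu, zero_add]⟩
    · exact ⟨v, hLv, hv⟩
  · exact ⟨u, hu, hMu⟩

lemma tendsto_add_smul (p w : E) : Tendsto (fun x : E × ℝ => x.1 + x.2 • w) (𝓝 (p, 0)) (𝓝 p) := by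
  have h : ContinuousAt (fun x : E × ℝ => x.1 + x.2 • w) (p, 0) := by fun_prop
  simpa only [ContinuousAt, zero_smul, add_zero] using h

lemma eventually_eq_zero_of_apply_add_smul_eq (hψ : HasStrictFDerivAt ψ M p) (hw : M w ≠ 0) :
    ∀ᶠ x : E × ℝ in 𝓝 (p, 0), ψ (x.1 + x.2 • w) = ψ x.1 → x.2 = 0 := by
  have hlim : Tendsto (fun x : E × ℝ => (x.1 + x.2 • w, x.1)) (𝓝 (p, 0)) (𝓝 (p, p)) :=
    (tendsto_add_smul p w).prodMk_nhds continuous_fst.continuousAt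
  have hO : (fun x : E × ℝ => x.1 + x.2 • w - x.1) =O[𝓝 (p, 0)] fun x => x.2 :=
    Asymptotics.IsBigO.of_bound ‖w‖ (.of_forall fun x => by
      rw [add_sub_cancel_left, norm_smul, mul_comm])
  have hbound := ((hψ.isLittleO.comp_tendsto hlim).trans_isBigO hO).def (half_pos (abs_pos.2 hw))
  filter_upwards [hbound] with x hx heq
  simp only [Function.comp_apply, heq, sub_self, add_sub_cancel_left, map_smul, smul_eq_mul,
    zero_sub, norm_neg, norm_mul, Real.norm_eq_abs] at hx
  by_contra hne
  nlinarith [mul_pos (abs_pos.2 hne) (abs_pos.2 hw)]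

lemma eventually_sign_change (hg : HasFDerivAt g L p) (hp : g p = 0) (hw : 0 < L w) :
    ∀ᶠ η : ℝ in 𝓝[>] 0, 0 < g (p + η • w) ∧ g (p + -η • w) < 0 := by
  have hline : HasDerivAt (fun s : ℝ => g (p + s • w)) (L w) 0 := by
    have hl : HasDerivAt (fun s : ℝ => p + s • w) ((1 : ℝ) • w) 0 :=
      ((hasDerivAt_id (0 : ℝ)).smul_const w).const_add p
    rw [one_smul] at hl
    exact HasFDerivAt.comp_hasDerivAt 0 (by rwa [zero_smul, add_zero]) hl
  have hsign := eventually_nhdsWithin_sign_eq_of_deriv_pos (hline.deriv.symm ▸ hw)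
    (by rw [zero_smul, add_zero, hp])
  have hneg : Tendsto (fun η : ℝ => -η) (𝓝 0) (𝓝 0) := by
    simpa only [neg_zero] using (continuous_neg (G := ℝ)).tendsto 0
  filter_upwards [hsign.filter_mono nhdsWithin_le_nhds,
    (hneg.eventually hsign).filter_mono nhdsWithin_le_nhds, self_mem_nhdsWithin]
    with η h₁ h₂ (hη : 0 < η)
  rw [sub_zero, sign_pos hη, sign_eq_one_iff] at h₁
  rw [sub_zero, sign_neg (neg_neg_of_pos hη), sign_eq_neg_one_iff] at h₂
  exact ⟨h₁, h₂⟩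

end Normed

lemma eventually_eventually_forall_mem_Icc {X : Type*} [TopologicalSpace X] {p : X}
    {P : X × ℝ → Prop} (h : ∀ᶠ x in 𝓝 (p, 0), P x) :
    ∀ᶠ η in 𝓝[>] (0 : ℝ), ∀ᶠ q in 𝓝 p, ∀ s ∈ Icc (-η) η, P (q, s) := by
  rw [nhds_prod_eq, eventually_prod_iff] at h
  obtain ⟨pa, hpa, pb, hpb, h⟩ := h
  obtain ⟨ε, hε, hball⟩ := Metric.eventually_nhds_iff.1 hpb
  filter_upwards [Ioo_mem_nhdsGT hε] with η hη
  filter_upwards [hpa] with q hq s hs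
  refine h hq (hball ?_)
  rw [Real.dist_eq, sub_zero]
  exact (abs_le.2 hs).trans_lt hη.2

lemma mem_nhdsWithin_of_isRegularSurface {S Z : Set Space} {ψ : Space → ℝ} {c : ℝ}
    (hψ : ContDiff ℝ 1 ψ) (hZ : ∀ q ∈ Z, ψ q = c) (hSZ : S ⊆ Z) (hS : IsRegularSurface S)
    {p : Space} (hp : p ∈ S) (hψp : fderiv ℝ ψ p ≠ 0) : S ∈ 𝓝[Z] p := by
  -- The function `g` cutting out `S` changes sign along a direction `w` in which `ψ` is injective
  -- near `p`. Hence the line through `q ∈ Z` in the direction `w` meets `S ⊆ Z`, and it can do so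
  -- only at `q`.
  obtain ⟨U, hU, hpU, g, hg, hg', hSU⟩ := hS.2.2 p hp
  have hmem q (hq : q ∈ U) : q ∈ S ↔ g q = 0 := by
    simpa only [mem_inter_iff, hq, and_true, mem_ofPred_eq, true_and] using Set.ext_iff.1 hSU q
  have hgp : HasFDerivAt g (fderiv ℝ g p) p :=
    ((hg.contDiffAt (hU.mem_nhds hpU)).differentiableAt (by simp)).hasFDerivAt
  obtain ⟨w, hgw, hψw⟩ := exists_pos_apply_and_apply_ne_zero (hg' p hpU) hψp
  have hloc : ∀ᶠ x : Space × ℝ in 𝓝 (p, 0),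
      (ψ (x.1 + x.2 • w) = ψ x.1 → x.2 = 0) ∧ x.1 + x.2 • w ∈ U :=
    (eventually_eq_zero_of_apply_add_smul_eq (hψ.contDiffAt.hasStrictFDerivAt one_ne_zero)
      hψw).and ((tendsto_add_smul p w).eventually (hU.mem_nhds hpU))
  obtain ⟨η, ⟨⟨hηpos, hηneg⟩, hseg⟩, hη⟩ :=
    (((eventually_sign_change hgp ((hmem p hpU).1 hp) hgw).and
      (eventually_eventually_forall_mem_Icc hloc)).and self_mem_nhdsWithin).exists
  replace hη : -η ≤ η := neg_le_self (le_of_lt hη)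
  have hcont s (hs : s ∈ Icc (-η) η) : ContinuousAt (fun q => g (q + s • w)) p :=
    ContinuousAt.comp (f := fun q => q + s • w)
      (hg.continuousOn.continuousAt (hU.mem_nhds (hseg.self_of_nhds s hs).2)) (by fun_prop)
  filter_upwards [self_mem_nhdsWithin, mem_nhdsWithin_of_mem_nhds hseg,
    mem_nhdsWithin_of_mem_nhds ((hcont η ⟨hη, le_rfl⟩).eventually (lt_mem_nhds hηpos)),
    mem_nhdsWithin_of_mem_nhds ((hcont (-η) ⟨le_rfl, hη⟩).eventually (gt_mem_nhds hηneg))]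
    with q hqZ hq hqpos hqneg
  obtain ⟨s, hs, hs0⟩ := intermediate_value_Icc (f := fun s : ℝ => g (q + s • w)) hη
    (hg.continuousOn.comp (by fun_prop) fun s hs => (hq s hs).2) ⟨le_of_lt hqneg, le_of_lt hqpos⟩
  have hsS : q + s • w ∈ S := (hmem _ (hq s hs).2).2 hs0
  obtain rfl : s = 0 := (hq s hs).1 ((hZ _ (hSZ hsS)).trans (hZ q hqZ).symm)
  rwa [zero_smul, add_zero] at hsS

lemma eq_of_isRegularSurface_subset {S Z : Set Space} {ψ : Space → ℝ} {c : ℝ}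
    (hψ : ContDiff ℝ 1 ψ) (hZ : ∀ q ∈ Z, ψ q = c) (hψ' : ∀ q ∈ Z, fderiv ℝ ψ q ≠ 0)
    (hZc : IsPreconnected Z) (hSZ : S ⊆ Z) (hS : IsRegularSurface S) : S = Z := by
  have : PreconnectedSpace Z := isPreconnected_iff_preconnectedSpace.1 hZc
  have hclopen : IsClopen (Subtype.val ⁻¹' S : Set Z) := by
    refine ⟨hS.2.1.preimage continuous_subtype_val, isOpen_iff_mem_nhds.2 fun p hp => ?_⟩
    rw [preimage_coe_mem_nhds_subtype]
    exact mem_nhdsWithin_of_isRegularSurface hψ hZ hSZ hS hp (hψ' p p.2)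
  obtain ⟨p, hp⟩ := hS.1
  have huniv := hclopen.eq_univ ⟨⟨p, hSZ hp⟩, hp⟩
  exact hSZ.antisymm fun q hq => huniv.symm.subset (mem_univ (⟨q, hq⟩ : Z))

/-! ### The normal form with `a = 3/2` and `b < 0` -/

section PeriodicOrbit

variable {F : Space → Space} {γ δ : ℝ → Space} {T T' : ℝ}

lemma IsPeriodicOrbit.isSolutionOn (h : IsPeriodicOrbit F γ T) : IsSolutionOn F γ univ :=
  ⟨isOpen_univ, ordConnected_univ, univ_nonempty, fun t _ => h.hasDerivAt t⟩

lemma IsPeriodicOrbit.isTrajectory (h : IsPeriodicOrbit F γ T) : IsTrajectory F γ univ :=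
  h.isSolutionOn.isTrajectory_univ

lemma IsPeriodicOrbit.returnsForward (h : IsPeriodicOrbit F γ T) : ReturnsForward γ univ := by
  have hγ : Continuous γ := continuous_iff_continuousAt.2 fun t => (h.hasDerivAt t).continuousAt
  exact ⟨range γ, h.periodic.compact_of_continuous h.pos.ne' hγ,
    fun t _ => ⟨t, trivial, le_rfl, t, rfl⟩⟩

lemma IsPeriodicOrbit.period_eq (hF : ContDiff ℝ 1 F) (hγ : IsPeriodicOrbit F γ T)
    (hδ : IsPeriodicOrbit F δ T') (h : γ 0 = δ 0) : T = T' := by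
  obtain rfl : γ = δ :=
    funext fun t => hγ.isSolutionOn.eqOn hF hδ.isSolutionOn (mem_univ 0) h (mem_univ t)
  rcases lt_trichotomy T T' with hlt | heq | hlt
  · exact absurd hγ.periodic (hδ.minimal T hγ.pos hlt)
  · exact heq
  · exact absurd hδ.periodic (hγ.minimal T' hδ.pos hlt)

end PeriodicOrbit

section NormalField

variable {b n r : ℝ}

lemma IsClosedOval.isIsochronousPeriodicSurface (h : IsClosedOval b n r) :
    IsIsochronousPeriodicSurface (normalField (3 / 2) b) (ovalCylinder n r) := by
  obtain ⟨T, hT⟩ := h.exists_isPeriodicOrbit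
  refine ⟨⟨isRegularSurface_ovalCylinder h.toIsOval, fun p hp => (hT p hp).imp fun γ hγ => ⟨T, hγ⟩⟩,
    T, fun γ T' hγ hγm => ?_⟩
  obtain ⟨δ, hδ, hδ0, -⟩ := hT (γ 0) (hγm ⟨0, rfl⟩)
  exact hγ.period_eq (contDiff_normalField _ _) hδ hδ0.symm

lemma mem_ovalCylinder_of_reflect_mem {p : Space} (h : reflect p ∈ ovalCylinder n r) :
    p ∈ ovalCylinder n r := by
  simpa [reflect, ovalCylinder] using h

theorem exists_isochronousPeriodicSurface_normalField (hb : b < 0) :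
    ∃ S : Set Space, IsIsochronousPeriodicSurface (normalField (3 / 2) b) S ∧
      Nonempty (S ≃ₜ ℝ × Circle) ∧
      (∀ S', IsIsochronousPeriodicSurface (normalField (3 / 2) b) S' → S' = S) ∧
      ∀ (γ : ℝ → Space) (I : Set ℝ), IsTrajectory (normalField (3 / 2) b) γ I →
        (∀ t ∈ I, γ t ∉ S) → EscapesBothWays γ I := by
  obtain ⟨n, r, h, huniq⟩ := exists_isClosedOval_forall_eq hb
  have hmem {γ : ℝ → Space} {I : Set ℝ} (hγ : IsTrajectory (normalField (3 / 2) b) γ I)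
      (hret : ReturnsForward γ I) : ∀ t ∈ I, γ t ∈ ovalCylinder n r := by
    obtain ⟨n', r', h', hm⟩ := hγ.exists_mem_ovalCylinder_of_isClosedOval hb hret
    obtain ⟨rfl, rfl⟩ := huniq n' r' h'
    exact hm
  refine ⟨ovalCylinder n r, h.isIsochronousPeriodicSurface, ⟨ovalHomeomorph h.toIsOval⟩,
    fun S hS => ?_, fun γ I hγ hI => ?_⟩
  · refine eq_of_isRegularSurface_subset (contDiff_energy (3 / 2) b)
      (fun q hq => ((mem_ovalCylinder_iff h.toIsOval).1 hq).1)
      (fun q hq => fderiv_energy_ne_zero h.toIsOval hq)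
      (isPreconnected_ovalCylinder h.toIsOval) (fun p hp => ?_) hS.1.1
    obtain ⟨γ, T, hγ, rfl, -⟩ := hS.1.2 p hp
    exact hmem hγ.isTrajectory hγ.returnsForward 0 trivial
  · obtain ⟨t, ht⟩ := hγ.nonempty
    refine escapesBothWays_of_not_returnsForward (fun hret => hI t ht (hmem hγ hret t ht))
      fun hret => hI t ht (mem_ovalCylinder_of_reflect_mem ?_)
    simpa only [neg_neg] using hmem hγ.reverse hret (-t) (by simpa only [Set.mem_neg, neg_neg])

end NormalField

/-! ### Invariant algebraic surfaces under polynomial conjugation -/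

section Polynomial

variable {σ τ : Type*}

lemma hasFDerivAt_eval [Fintype σ] (f : MvPolynomial σ ℝ) (p : σ → ℝ) :
    HasFDerivAt (fun q : σ → ℝ => MvPolynomial.eval q f)
      (∑ i, MvPolynomial.eval p (MvPolynomial.pderiv i f) •
        ContinuousLinearMap.proj (R := ℝ) (φ := fun _ : σ => ℝ) i) p := by
  classical
  induction f using MvPolynomial.induction_on with
  | C a =>
    simp only [MvPolynomial.eval_C, MvPolynomial.pderiv_C, map_zero, zero_smul,
      Finset.sum_const_zero]
    exact hasFDerivAt_const a p
  | add f g hf hg =>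
    simp only [map_add, add_smul, Finset.sum_add_distrib]
    exact hf.add hg
  | mul_X f j hf =>
    have hprod := hf.mul (ContinuousLinearMap.proj (R := ℝ) (φ := fun _ : σ => ℝ) j).hasFDerivAt
    simp only [map_mul, MvPolynomial.eval_X]
    refine hprod.congr_fderiv ?_
    simp only [Derivation.leibniz, MvPolynomial.pderiv_X, smul_eq_mul, map_add, map_mul,
      MvPolynomial.eval_X, add_smul, Finset.sum_add_distrib, Finset.smul_sum, mul_smul]
    congr 1
    rw [Finset.sum_eq_single j (fun i _ hi => by simp [Pi.single_eq_of_ne hi.symm]) (by simp)]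
    simp

lemma fderiv_eval_apply [Fintype σ] (f : MvPolynomial σ ℝ) (p v : σ → ℝ) :
    fderiv ℝ (fun q => MvPolynomial.eval q f) p v =
      ∑ i, v i * MvPolynomial.eval p (MvPolynomial.pderiv i f) := by
  rw [(hasFDerivAt_eval f p).fderiv]
  simp [mul_comm]

/-- A map between affine spaces whose coordinates are polynomials: conjugations with polynomial
inverse are the ones that preserve algebraic surfaces. -/
def IsPolynomialMap {R : Type*} [CommSemiring R] (e : (σ → R) → τ → R) : Prop :=
  ∃ Q : τ → MvPolynomial σ R, ∀ p i, e p i = MvPolynomial.eval p (Q i)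

lemma eval_bind₁_eq {R : Type*} [CommSemiring R] {e : (σ → R) → τ → R}
    {Q : τ → MvPolynomial σ R} (hQ : ∀ p i, e p i = MvPolynomial.eval p (Q i))
    (f : MvPolynomial τ R) (p : σ → R) :
    MvPolynomial.eval p (MvPolynomial.bind₁ Q f) = MvPolynomial.eval (e p) f := by
  rw [show e p = fun i => MvPolynomial.eval p (Q i) from funext (hQ p)]
  exact MvPolynomial.eval₂Hom_bind₁ (RingHom.id R) p Q f

lemma eq_C_of_forall_eval_eq {R : Type*} [CommRing R] [IsDomain R] [Infinite R]
    {f : MvPolynomial σ R} {c : R} (h : ∀ p, MvPolynomial.eval p f = c) : f = MvPolynomial.C c :=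
  MvPolynomial.funext fun p => by rw [h, MvPolynomial.eval_C]

end Polynomial

lemma IsConj.isInvariantAlgebraic {e : Space ≃ Space} {F G : Space → Space} (h : IsConj e F G)
    (hpoly : IsPolynomialMap e.symm) {S : Set Space} (hS : IsInvariantAlgebraic F S) :
    IsInvariantAlgebraic G (e '' S) := by
  obtain ⟨f, K, hdeg, hSf, hK⟩ := hS
  obtain ⟨Q, hQ⟩ := hpoly
  have hev := eval_bind₁_eq hQ
  refine ⟨MvPolynomial.bind₁ Q f, MvPolynomial.bind₁ Q K, fun h0 => hdeg ?_, ?_, fun q => ?_⟩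
  · rw [MvPolynomial.totalDegree_eq_zero_iff_eq_C] at h0
    have hconst : ∀ p, MvPolynomial.eval p f = (MvPolynomial.bind₁ Q f).coeff 0 := fun p => by
      rw [← e.symm_apply_apply p, ← hev, h0, MvPolynomial.eval_C, MvPolynomial.coeff_zero_C]
    rw [eq_C_of_forall_eval_eq hconst, MvPolynomial.totalDegree_C]
  · rw [e.image_eq_preimage_symm, hSf]
    ext q
    simp only [Set.mem_preimage, Set.mem_ofPred_eq, hev]
  · have hcomp : (fun q : Space => MvPolynomial.eval q (MvPolynomial.bind₁ Q f)) =
        (fun p : Space => MvPolynomial.eval p f) ∘ e.symm := funext (hev f)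
    rw [← fderiv_eval_apply, hev, hev, ← hK, ← fderiv_eval_apply, hcomp,
      fderiv_comp q (hasFDerivAt_eval f _).differentiableAt (h.symm.differentiable q),
      ContinuousLinearMap.comp_apply, h.symm.fderiv_apply]

/-! ### Invariant polynomials on the level curves `v² = u³ + E` -/

section LevelCurve

open Polynomial

/-- The right-hand side `u³ + E` of the equation `v² = u³ + E` of a level curve. -/
noncomputable def cubic (E : ℝ) : ℝ[X] := X ^ 3 + C E

/-- The coordinate ring `ℝ[u] ⊕ ℝ[u] v` of the level curve `v² = u³ + E`. -/
abbrev LevelRing (E : ℝ) : Type := QuadraticAlgebra ℝ[X] (cubic E) 0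

variable {E : ℝ}

lemma natDegree_cubic (E : ℝ) : (cubic E).natDegree = 3 :=
  natDegree_X_pow_add_C

lemma cubic_ne_zero (E : ℝ) : cubic E ≠ 0 :=
  (monic_X_pow_add_C E three_ne_zero).ne_zero

lemma derivative_cubic (E : ℝ) : derivative (cubic E) = 2 * (C (3 / 2) * X ^ 2) := by
  have hconst : (2 * C (3 / 2) : ℝ[X]) = C 3 := by
    rw [← map_ofNat C 2, ← C_mul]
    norm_num
  rw [← mul_assoc, hconst, cubic, derivative_add, derivative_C, add_zero, derivative_X_pow]
  norm_num

lemma natDegree_cubic_mul_sq {b : ℝ[X]} (hb : b ≠ 0) :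
    (cubic E * b ^ 2).natDegree = 3 + 2 * b.natDegree := by
  rw [natDegree_mul (cubic_ne_zero E) (pow_ne_zero 2 hb), natDegree_cubic, natDegree_pow]

namespace LevelRing

open QuadraticAlgebra

lemma norm_eq (z : LevelRing E) : z.norm = z.re ^ 2 - cubic E * z.im ^ 2 := by
  rw [norm_def]
  ring

-- The two terms of the norm have degrees of different parity, so they cannot cancel.
lemma three_le_natDegree_norm {z : LevelRing E} (hz : z.im ≠ 0) : 3 ≤ z.norm.natDegree := by
  have hre : (z.re ^ 2).natDegree = 2 * z.re.natDegree := natDegree_pow z.re 2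
  have him := natDegree_cubic_mul_sq (E := E) hz
  have hne : (z.re ^ 2).natDegree ≠ (cubic E * z.im ^ 2).natDegree := by omega
  rw [norm_eq]
  rcases lt_or_gt_of_ne hne with h | h
  · rw [natDegree_sub_eq_right_of_natDegree_lt h]
    omega
  · rw [natDegree_sub_eq_left_of_natDegree_lt h]
    omega

lemma im_eq_zero_of_natDegree_norm_eq_zero {z : LevelRing E} (h : z.norm.natDegree = 0) :
    z.im = 0 := by
  by_contra hz
  have := three_le_natDegree_norm hz
  omega

lemma eq_zero_of_norm_eq_zero {z : LevelRing E} (h : z.norm = 0) : z = 0 := by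
  have him : z.im = 0 := im_eq_zero_of_natDegree_norm_eq_zero (by rw [h, natDegree_zero])
  rw [norm_eq, him] at h
  exact QuadraticAlgebra.ext (by simpa using h) him

instance : NoZeroDivisors (LevelRing E) where
  eq_zero_or_eq_zero_of_mul_eq_zero {z w} h := by
    have hnorm : z.norm * w.norm = 0 := by rw [← map_mul, h, QuadraticAlgebra.norm_zero]
    exact (mul_eq_zero.1 hnorm).imp eq_zero_of_norm_eq_zero eq_zero_of_norm_eq_zero

/-- The derivation `v ∂/∂u + (3/2) u² ∂/∂v` of the coordinate ring of `v² = u³ + E`. -/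
noncomputable instance : Differential (LevelRing E) where
  deriv := Derivation.mk'
    { toFun := fun z =>
        ⟨C (3 / 2) * X ^ 2 * z.im + cubic E * derivative z.im, derivative z.re⟩
      map_add' := fun z w => by
        ext1
        · simp; ring
        · simp
      map_smul' := fun m z => by
        ext1
        · simp; ring
        · simp }
    fun z w => by
      ext1
      · simp
        ring
      · simp [derivative_cubic]
        ring

open scoped Differential

lemma deriv_re (z : LevelRing E) :
    (z′).re = C (3 / 2) * X ^ 2 * z.im + cubic E * derivative z.im := rfl

lemma deriv_im (z : LevelRing E) : (z′).im = derivative z.re := rfl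

lemma deriv_C (r : ℝ) : (⟨C r, 0⟩ : LevelRing E)′ = 0 := by
  ext1
  · simp [deriv_re]
  · simp [deriv_im]

lemma deriv_u : (⟨X, 0⟩ : LevelRing E)′ = ⟨0, 1⟩ := by
  ext1
  · simp [deriv_re]
  · simp [deriv_im]

lemma deriv_v : (⟨0, 1⟩ : LevelRing E)′ = ⟨C (3 / 2), 0⟩ * ⟨X, 0⟩ ^ 2 := by
  ext1
  · simp [deriv_re, sq]
  · simp [deriv_im, sq]

lemma derivative_norm_of_deriv_eq_mul {z κ : LevelRing E} (h : z′ = κ * z) :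
    derivative z.norm = 2 * κ.im * z.norm := by
  have hre := congrArg QuadraticAlgebra.re h
  have him := congrArg QuadraticAlgebra.im h
  rw [deriv_re, re_mul] at hre
  rw [deriv_im, im_mul] at him
  rw [norm_eq, derivative_sub, derivative_mul, derivative_sq, derivative_sq, derivative_cubic,
    map_ofNat C 2]
  linear_combination 2 * z.re * him - 2 * z.im * hre

lemma eq_const_of_deriv_eq_mul {z κ : LevelRing E} (hz : z ≠ 0) (h : z′ = κ * z) :
    κ = 0 ∧ ∃ r : ℝ, r ≠ 0 ∧ z = ⟨C r, 0⟩ := by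
  have hnorm := derivative_norm_of_deriv_eq_mul h
  have hκ : κ.im = 0 := by
    by_contra hκ
    have hlt := degree_derivative_lt fun h0 => hz (eq_zero_of_norm_eq_zero h0)
    rw [hnorm, mul_comm] at hlt
    exact hlt.not_ge (degree_le_mul_left z.norm (mul_ne_zero two_ne_zero hκ))
  rw [hκ, mul_zero, zero_mul] at hnorm
  have hdeg := Polynomial.derivative_eq_zero.1 hnorm
  have him := im_eq_zero_of_natDegree_norm_eq_zero hdeg
  have hre : z.re.natDegree = 0 := by simpa [norm_eq, him] using hdeg
  obtain ⟨r, hr⟩ := natDegree_eq_zero.1 hre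
  obtain rfl : ⟨C r, 0⟩ = z := QuadraticAlgebra.ext hr him.symm
  rw [deriv_C] at h
  refine ⟨(mul_eq_zero.1 h.symm).resolve_right hz, r, fun hr0 => hz ?_, rfl⟩
  rw [hr0, C_0]
  rfl

lemma eq_zero_of_deriv_eq_mul_X {z : LevelRing E} {r : ℝ} (h : z′ = ⟨C r * X, 0⟩) : r = 0 := by
  have hre : C (3 / 2) * X ^ 2 * z.im + cubic E * derivative z.im = C r * X :=
    congrArg QuadraticAlgebra.re h
  by_cases him : z.im = 0
  · simpa [him] using hre.symm
  have hderiv : derivative (cubic E * z.im ^ 2) = C (2 * r) * X * z.im := by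
    rw [derivative_mul, derivative_sq, derivative_cubic, Polynomial.C_mul, map_ofNat C 2]
    linear_combination 2 * z.im * hre
  have hle : (C (2 * r) * X * z.im).natDegree ≤ 1 + z.im.natDegree :=
    natDegree_mul_le.trans (Nat.add_le_add_right ((natDegree_C_mul_le _ _).trans natDegree_X_le) _)
  rw [← hderiv, natDegree_derivative, natDegree_cubic_mul_sq him] at hle
  omega

/-- Evaluation at the point `(u, v)` of the level curve `v² = u³ + E`. -/
noncomputable def evalAt {u v : ℝ} (h : v ^ 2 = u ^ 3 + E) : LevelRing E →+* ℝ where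
  toFun z := z.re.eval u + z.im.eval u * v
  map_one' := by simp
  map_zero' := by simp
  map_add' z w := by simp; ring
  map_mul' z w := by
    simp [cubic]
    linear_combination (-z.im.eval u * w.im.eval u) * h

/-- The derivation of `LevelRing E [x]` induced by the field `u ∂/∂x + v ∂/∂u + (3/2) u² ∂/∂v`. -/
noncomputable def fieldDeriv (f : (LevelRing E)[X]) : (LevelRing E)[X] :=
  Differential.mapCoeffs f + C ⟨X, 0⟩ * derivative f

lemma fieldDeriv_add (f g : (LevelRing E)[X]) :
    fieldDeriv (f + g) = fieldDeriv f + fieldDeriv g := by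
  simp only [fieldDeriv, map_add]
  ring

lemma fieldDeriv_mul (f g : (LevelRing E)[X]) :
    fieldDeriv (f * g) = f * fieldDeriv g + g * fieldDeriv f := by
  simp only [fieldDeriv, Derivation.leibniz, smul_eq_mul, derivative_mul]
  ring

lemma fieldDeriv_C (z : LevelRing E) : fieldDeriv (C z) = C (z′) := by
  simp [fieldDeriv]

lemma fieldDeriv_X : fieldDeriv (X : (LevelRing E)[X]) = C ⟨X, 0⟩ := by
  simp [fieldDeriv]

lemma coeff_fieldDeriv (f : (LevelRing E)[X]) (k : ℕ) :
    (fieldDeriv f).coeff k = (f.coeff k)′ + ⟨X, 0⟩ * (f.coeff (k + 1) * (k + 1)) := by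
  rw [fieldDeriv, coeff_add, Differential.coeff_mapCoeffs, coeff_C_mul, coeff_derivative]

lemma natDegree_fieldDeriv_le (f : (LevelRing E)[X]) :
    (fieldDeriv f).natDegree ≤ f.natDegree := by
  refine natDegree_le_iff_coeff_eq_zero.2 fun k hk => ?_
  rw [coeff_fieldDeriv, coeff_eq_zero_of_natDegree_lt hk,
    coeff_eq_zero_of_natDegree_lt (hk.trans k.lt_succ_self), map_zero, zero_mul, mul_zero, add_zero]

lemma exists_eq_C_of_fieldDeriv_eq_mul {f K : (LevelRing E)[X]} (hf : f ≠ 0)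
    (h : fieldDeriv f = K * f) : ∃ κ, K = C κ := by
  rcases eq_or_ne K 0 with rfl | hK
  · exact ⟨0, C_0.symm⟩
  · have hle := natDegree_fieldDeriv_le f
    rw [h, natDegree_mul hK hf] at hle
    exact ⟨_, eq_C_of_natDegree_eq_zero (by omega)⟩

-- The leading coefficient is a constant `r`, and the next one would be a primitive of `-n r u`.
lemma eq_const_of_fieldDeriv_eq_mul {f K : (LevelRing E)[X]} (hf : f ≠ 0)
    (h : fieldDeriv f = K * f) : ∃ r : ℝ, f = C ⟨C r, 0⟩ := by
  obtain ⟨κ, rfl⟩ := exists_eq_C_of_fieldDeriv_eq_mul hf h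
  have hcoeff : ∀ k, (f.coeff k)′ + ⟨X, 0⟩ * (f.coeff (k + 1) * (k + 1)) = κ * f.coeff k :=
    fun k => by rw [← coeff_fieldDeriv, h, coeff_C_mul]
  have hlead := hcoeff f.natDegree
  rw [coeff_eq_zero_of_natDegree_lt (Nat.lt_succ_self _), zero_mul, mul_zero, add_zero] at hlead
  obtain ⟨rfl, r, hr0, hr⟩ := eq_const_of_deriv_eq_mul (leadingCoeff_ne_zero.2 hf) hlead
  have hdeg : f.natDegree = 0 := by
    by_contra hne
    obtain ⟨m, hm⟩ := Nat.exists_eq_succ_of_ne_zero hne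
    rw [leadingCoeff, hm] at hr
    have hnext := hcoeff m
    rw [← Nat.succ_eq_add_one, hr, zero_mul] at hnext
    have hprim : (f.coeff m)′ = ⟨C (-(r * (m + 1))) * X, 0⟩ := by
      rw [eq_neg_of_add_eq_zero_left hnext]
      ext1
      · simp
        ring
      · simp
    have hzero := eq_zero_of_deriv_eq_mul_X hprim
    rw [neg_eq_zero, mul_eq_zero] at hzero
    exact hzero.elim hr0 m.cast_add_one_ne_zero
  exact ⟨r, by rw [← hr, leadingCoeff, hdeg, ← eq_C_of_natDegree_eq_zero hdeg]⟩

end LevelRing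

/-- Restriction of polynomials in `(x, u, v)` to the level `v² = u³ + E`. -/
noncomputable def restrictLevel (E : ℝ) : MvPolynomial (Fin 3) ℝ →ₐ[ℝ] (LevelRing E)[X] :=
  MvPolynomial.aeval ![X, C ⟨X, 0⟩, C ⟨0, 1⟩]

lemma restrictLevel_C (r : ℝ) : restrictLevel E (MvPolynomial.C r) = C ⟨C r, 0⟩ :=
  MvPolynomial.algHom_C _ r

lemma restrictLevel_X (i : Fin 3) :
    restrictLevel E (MvPolynomial.X i) = ![X, C ⟨X, 0⟩, C ⟨0, 1⟩] i :=
  MvPolynomial.aeval_X _ i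

lemma eval_eq_eval₂_restrictLevel (f : MvPolynomial (Fin 3) ℝ) {p : Space}
    (hp : p 2 ^ 2 = p 1 ^ 3 + E) :
    MvPolynomial.eval p f = (restrictLevel E f).eval₂ (LevelRing.evalAt hp) (p 0) := by
  have hhom : MvPolynomial.eval p =
      (eval₂RingHom (LevelRing.evalAt hp) (p 0)).comp (restrictLevel E).toRingHom := by
    refine MvPolynomial.ringHom_ext (fun r => ?_) fun i => ?_
    · change _ = eval₂ _ _ (restrictLevel E (MvPolynomial.C r))
      simp [restrictLevel_C, LevelRing.evalAt, -MvPolynomial.algHom_C]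
    · fin_cases i <;> simp [restrictLevel_X, LevelRing.evalAt]
  exact congrArg (fun φ => φ f) hhom

lemma mkDerivation_eq_sum_pderiv {σ R : Type*} [Fintype σ] [CommSemiring R]
    (Q : σ → MvPolynomial σ R) :
    MvPolynomial.mkDerivation R Q = ∑ i, Q i • MvPolynomial.pderiv i := by
  classical
  refine MvPolynomial.derivation_ext fun j => ?_
  rw [MvPolynomial.mkDerivation_X, ← Derivation.coeFnAddMonoidHom_apply, map_sum, Finset.sum_apply,
    Finset.sum_eq_single j]
  · simp
  · intro i _ hi
    simp [MvPolynomial.pderiv_X_of_ne hi.symm]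
  · simp

/-- The field `normalField (3 / 2) 0` as a derivation of the polynomial ring. -/
noncomputable def normalDerivation :
    Derivation ℝ (MvPolynomial (Fin 3) ℝ) (MvPolynomial (Fin 3) ℝ) :=
  MvPolynomial.mkDerivation ℝ
    ![MvPolynomial.X 1, MvPolynomial.X 2, MvPolynomial.C (3 / 2) * MvPolynomial.X 1 ^ 2]

lemma eval_normalDerivation (f : MvPolynomial (Fin 3) ℝ) (p : Space) :
    MvPolynomial.eval p (normalDerivation f) =
      ∑ i, normalField (3 / 2) 0 p i * MvPolynomial.eval p (MvPolynomial.pderiv i f) := by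
  rw [normalDerivation, mkDerivation_eq_sum_pderiv]
  simp [Fin.sum_univ_three, normalField]

lemma restrictLevel_normalDerivation (f : MvPolynomial (Fin 3) ℝ) :
    restrictLevel E (normalDerivation f) = LevelRing.fieldDeriv (restrictLevel E f) := by
  induction f using MvPolynomial.induction_on with
  | C r =>
    rw [restrictLevel_C, LevelRing.fieldDeriv_C, LevelRing.deriv_C, C_0,
      MvPolynomial.derivation_C, map_zero]
  | add f g hf hg => rw [map_add, map_add, hf, hg, map_add, LevelRing.fieldDeriv_add]
  | mul_X f j hf =>
    have hX : restrictLevel E (normalDerivation (MvPolynomial.X j)) =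
        LevelRing.fieldDeriv (restrictLevel E (MvPolynomial.X j)) := by
      rw [normalDerivation, MvPolynomial.mkDerivation_X]
      fin_cases j
      · simp [restrictLevel_X, LevelRing.fieldDeriv_X]
      · simp [restrictLevel_X, LevelRing.fieldDeriv_C, LevelRing.deriv_u]
      · simp [restrictLevel_X, restrictLevel_C, LevelRing.fieldDeriv_C, LevelRing.deriv_v,
          -MvPolynomial.algHom_C]
    simp only [Derivation.leibniz, smul_eq_mul, map_add, map_mul, hf, hX,
      LevelRing.fieldDeriv_mul]

lemma exists_eval_eq_of_invariant {f K : MvPolynomial (Fin 3) ℝ}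
    (h : ∀ p : Space, ∑ i, normalField (3 / 2) 0 p i * MvPolynomial.eval p
      (MvPolynomial.pderiv i f) = MvPolynomial.eval p K * MvPolynomial.eval p f) (E : ℝ) :
    ∃ r : ℝ, ∀ p : Space, p 2 ^ 2 = p 1 ^ 3 + E → MvPolynomial.eval p f = r := by
  have hinv : normalDerivation f = K * f :=
    MvPolynomial.funext fun p => by rw [eval_normalDerivation, h, map_mul]
  rcases eq_or_ne (restrictLevel E f) 0 with h0 | h0
  · exact ⟨0, fun p hp => by rw [eval_eq_eval₂_restrictLevel f hp, h0, eval₂_zero]⟩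
  · have hres := restrictLevel_normalDerivation (E := E) f
    rw [hinv, map_mul] at hres
    obtain ⟨r, hr⟩ := LevelRing.eq_const_of_fieldDeriv_eq_mul h0 hres.symm
    refine ⟨r, fun p hp => ?_⟩
    rw [eval_eq_eval₂_restrictLevel f hp, hr, eval₂_C]
    simp [LevelRing.evalAt]

end LevelCurve

/-! ### The cuspidal surface -/

lemma eq_zero_of_forall_mem_eval_eq_zero {𝕜 σ : Type*} [NontriviallyNormedField 𝕜] [Finite σ]
    {f : MvPolynomial σ 𝕜} {U : Set (σ → 𝕜)} (hU : IsOpen U) (hne : U.Nonempty)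
    (h : ∀ p ∈ U, MvPolynomial.eval p f = 0) : f = 0 := by
  obtain ⟨p, hp⟩ := hne
  obtain ⟨u, hu, hsub⟩ := isOpen_pi_iff'.1 hU p hp
  refine MvPolynomial.funext_set u
    (fun i => infinite_of_mem_nhds (p i) ((hu i).1.mem_nhds (hu i).2)) fun q hq => ?_
  rw [h q (hsub hq), map_zero]

lemma mem_standardCuspidal_iff {p : Space} : p ∈ standardCuspidal ↔ energy (3 / 2) 0 p = 0 := by
  rw [standardCuspidal, mem_ofPred_eq, ← sub_eq_zero, energy]
  norm_num

lemma isPreconnected_standardCuspidal : IsPreconnected standardCuspidal := by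
  have hrange : standardCuspidal =
      range fun q : ℝ × ℝ => (![q.1, q.2 ^ 2, q.2 ^ 3] : Space) := by
    ext p
    constructor
    · intro (hp : p 2 ^ 2 = p 1 ^ 3)
      refine ⟨(p 0, p 2 / p 1), ?_⟩
      rcases eq_or_ne (p 1) 0 with hu | hu
      · have hv : p 2 = 0 := by simpa [hu] using hp
        ext i
        fin_cases i <;> simp [hu, hv]
      · have hv : (p 2 / p 1) ^ 2 = p 1 := by
          rw [div_pow, hp]
          field_simp
        ext i
        fin_cases i
        · rfl
        · exact hv
        · change (p 2 / p 1) ^ 3 = p 2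
          rw [pow_succ, hv, mul_div_cancel₀ _ hu]
    · rintro ⟨q, rfl⟩
      change (q.2 ^ 3) ^ 2 = (q.2 ^ 2) ^ 3
      ring
  rw [hrange]
  exact isPreconnected_range
    (contDiff_vec₃ (n := 0) (by fun_prop) (by fun_prop) (by fun_prop)).continuous

-- Every point is joined, inside the region and along a line of constant `x` and `v`, to the half
-- space `u < 0`.
lemma isPreconnected_cube_lt_sq : IsPreconnected {p : Space | p 1 ^ 3 < p 2 ^ 2} := by
  have hlin : ∀ i : Fin 3, IsLinearMap ℝ fun p : Space => p i := fun i => ⟨by simp, by simp⟩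
  have hneg : ∀ p : Space, p 1 < 0 → p 1 ^ 3 < p 2 ^ 2 := fun p hp =>
    (Odd.pow_neg (by decide) hp).trans_le (sq_nonneg _)
  refine isPreconnected_of_forall ![0, -1, 0] fun p (hp : p 1 ^ 3 < p 2 ^ 2) => ?_
  refine ⟨{q | q 1 < 0} ∪ ({q | q 0 = p 0} ∩ {q | q 2 = p 2} ∩ {q | q 1 ≤ p 1}), ?_, Or.inl ?_,
    Or.inr ⟨⟨rfl, rfl⟩, le_refl (p 1)⟩, ?_⟩
  · rintro q (hq | ⟨⟨-, hv⟩, hu⟩)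
    · exact hneg q hq
    · rw [mem_ofPred_eq, hv]
      exact (Odd.strictMono_pow (by decide)).monotone hu |>.trans_lt hp
  · simp
  · refine IsPreconnected.union ![p 0, min (p 1) (-1), p 2] (by simp) (by simp)
      (convex_halfSpace_lt (hlin 1) 0).isPreconnected ?_
    exact ((convex_hyperplane (hlin 0) _).inter (convex_hyperplane (hlin 2) _)).inter
      (convex_halfSpace_le (hlin 1) _) |>.isPreconnected

-- If `L ≠ 0`, then `G` changes sign along a line through the origin transversal to the plane
-- `v = 0`; near the origin, both sides of that line lie in the connected region `v² > u³`.
lemma eq_zero_of_zeroSet_eq_standardCuspidal {G : Space → ℝ} (hG : Continuous G)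
    (hzero : ∀ p, G p = 0 ↔ p ∈ standardCuspidal) {L : Space →L[ℝ] ℝ}
    (hL : HasFDerivAt G L 0) : L = 0 := by
  by_contra hL0
  have hproj : (ContinuousLinearMap.proj 2 : Space →L[ℝ] ℝ) ≠ 0 :=
    DFunLike.ne_iff.2 ⟨Pi.single 2 1, by simp⟩
  obtain ⟨w, hLw, hw⟩ := exists_pos_apply_and_apply_ne_zero hL0 hproj
  have hlt : 0 < w 2 ^ 2 := sq_pos_of_ne_zero hw
  have hsmall : ∀ᶠ η : ℝ in 𝓝 0, |η| * |w 1 ^ 3| < w 2 ^ 2 :=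
    ContinuousAt.eventually_lt (by fun_prop) continuousAt_const (by simpa using hlt)
  obtain ⟨η, ⟨hpos, hneg⟩, hη, hη0 : 0 < η⟩ := ((eventually_sign_change hL
    ((hzero 0).2 (by simp [standardCuspidal])) hLw).and
      ((hsmall.filter_mono nhdsWithin_le_nhds).and self_mem_nhdsWithin)).exists
  have hmem : ∀ s : ℝ, |s| = η → (0 : Space) + s • w ∈ {p : Space | p 1 ^ 3 < p 2 ^ 2} := by
    intro s hs
    have hs0 : 0 < s ^ 2 := by rw [← sq_abs, hs]; positivity
    have hle : s * w 1 ^ 3 ≤ |η| * |w 1 ^ 3| := by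
      rw [← hs, abs_abs, ← abs_mul]
      exact le_abs_self _
    simp only [mem_ofPred_eq, zero_add, Pi.smul_apply, smul_eq_mul]
    nlinarith
  obtain ⟨p, hp, hGp⟩ := isPreconnected_cube_lt_sq.intermediate_value
    (hmem (-η) (by rw [abs_neg, abs_of_pos hη0])) (hmem η (abs_of_pos hη0)) hG.continuousOn
    ⟨hneg.le, hpos.le⟩
  exact (show p 1 ^ 3 < p 2 ^ 2 from hp).ne' ((hzero p).1 hGp)

lemma isInvariantAlgebraic_standardCuspidal :
    IsInvariantAlgebraic (normalField (3 / 2) 0) standardCuspidal := by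
  refine ⟨MvPolynomial.X 2 ^ 2 - MvPolynomial.X 1 ^ 3, 0, fun h => ?_, ?_, fun p => ?_⟩
  · rw [MvPolynomial.totalDegree_eq_zero_iff_eq_C] at h
    have h0 := congrArg (MvPolynomial.eval (![0, 0, 0] : Space)) h
    have h1 := congrArg (MvPolynomial.eval (![0, 0, 1] : Space)) h
    rw [MvPolynomial.eval_C] at h0 h1
    simp [← h0] at h1
  · ext p
    simp [standardCuspidal, sub_eq_zero]
  · rw [Fin.sum_univ_three]
    simp [normalField, MvPolynomial.pderiv_X]
    ring

lemma isCuspidal_standardCuspidal : IsCuspidal standardCuspidal :=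
  ⟨Equiv.refl _, contDiff_id, contDiff_id, by simp⟩

lemma IsCuspidal.isPreconnected {S : Set Space} (hS : IsCuspidal S) : IsPreconnected S := by
  obtain ⟨e, -, he', heS⟩ := hS
  rw [← e.symm_image_image S, heS]
  exact isPreconnected_standardCuspidal.image _ he'.continuous.continuousOn

lemma IsCuspidal.nonempty {S : Set Space} (hS : IsCuspidal S) : S.Nonempty := by
  obtain ⟨e, -, -, heS⟩ := hS
  rw [← image_nonempty (f := e), heS]
  exact ⟨0, by simp [standardCuspidal]⟩

lemma eq_zero_of_isCuspidal_energy_eq {c : ℝ} (hS : IsCuspidal {p | energy (3 / 2) 0 p = c}) :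
    c = 0 := by
  obtain ⟨e, he, he', heS⟩ := hS
  have hzero : ∀ q, energy (3 / 2) 0 (e.symm q) - c = 0 ↔ q ∈ standardCuspidal := fun q => by
    rw [← heS, e.image_eq_preimage_symm, sub_eq_zero]
    rfl
  have hG : ContDiff ℝ 1 fun q => energy (3 / 2) 0 (e.symm q) - c :=
    ((contDiff_energy _ _).comp (he'.of_le (by simp))).sub contDiff_const
  have hG0 := (hG.differentiable one_ne_zero 0).hasFDerivAt
  rw [eq_zero_of_zeroSet_eq_standardCuspidal hG.continuous hzero hG0] at hG0
  have hcomp : energy (3 / 2) 0 = fun p => (energy (3 / 2) 0 (e.symm (e p)) - c) + c :=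
    funext fun p => by rw [e.symm_apply_apply, sub_add_cancel]
  have hcrit : HasFDerivAt (energy (3 / 2) 0) (0 : Space →L[ℝ] ℝ) (e.symm 0) := by
    rw [hcomp]
    refine HasFDerivAt.add_const c ?_
    rw [← e.apply_symm_apply 0] at hG0
    exact hG0.comp _ (he.differentiable (by simp) _).hasFDerivAt
  obtain ⟨hv, hu⟩ := eq_zero_of_fderiv_energy_eq_zero hcrit.fderiv
  have hu : e.symm 0 1 = 0 := by simpa using hu
  have hc : energy (3 / 2) 0 (e.symm 0) = c :=
    sub_eq_zero.1 ((hzero 0).2 (by simp [standardCuspidal]))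
  rw [← hc, energy, hu, hv]
  norm_num

-- The zero set of `f` is a union of levels of the energy; by connectedness it would contain an open
-- set of intermediate levels if it were not a single one.
lemma eq_standardCuspidal {S : Set Space}
    (hS : IsCuspidalInvariantSurface (normalField (3 / 2) 0) S) : S = standardCuspidal := by
  obtain ⟨⟨f, K, hdeg, rfl, hK⟩, hcusp⟩ := hS
  set S := {p : Space | MvPolynomial.eval p f = 0}
  have hsat : ∀ p ∈ S, ∀ q, energy (3 / 2) 0 q = energy (3 / 2) 0 p → q ∈ S := by
    intro p (hp : MvPolynomial.eval p f = 0) q hpq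
    obtain ⟨r, hr⟩ := exists_eval_eq_of_invariant hK (energy (3 / 2) 0 p)
    have hlevel : ∀ x : Space, energy (3 / 2) 0 x = energy (3 / 2) 0 p →
        MvPolynomial.eval x f = r := fun x hx => hr x (by rw [← hx, energy]; ring)
    exact (hlevel q hpq).trans ((hlevel p rfl).symm.trans hp)
  have hcont := (contDiff_energy (3 / 2) 0 (m := 0)).continuous
  have hle : ∀ p ∈ S, ∀ q ∈ S, energy (3 / 2) 0 q ≤ energy (3 / 2) 0 p := by
    intro p hp q hq
    by_contra! hlt
    have hmid : ∀ c ∈ Ioo (energy (3 / 2) 0 p) (energy (3 / 2) 0 q),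
        ∃ x ∈ S, energy (3 / 2) 0 x = c := fun c hc =>
      hcusp.isPreconnected.intermediate_value hp hq hcont.continuousOn (Ioo_subset_Icc_self hc)
    obtain ⟨c, hc⟩ := exists_between hlt
    obtain ⟨x₀, -, hx₀⟩ := hmid c hc
    have hf := eq_zero_of_forall_mem_eval_eq_zero (isOpen_Ioo.preimage hcont)
      ⟨x₀, by rwa [mem_preimage, hx₀]⟩ fun x hx =>
        let ⟨y, hy, hyx⟩ := hmid _ hx
        hsat y hy x hyx.symm
    exact hdeg (by rw [hf, MvPolynomial.totalDegree_zero])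
  obtain ⟨p₀, hp₀⟩ := hcusp.nonempty
  have hSlevel : S = {p | energy (3 / 2) 0 p = energy (3 / 2) 0 p₀} := ext fun p =>
    ⟨fun hp => le_antisymm (hle p₀ hp₀ p hp) (hle p hp p₀ hp₀), hsat p₀ hp₀ p⟩
  rw [hSlevel] at hcusp ⊢
  rw [eq_zero_of_isCuspidal_energy_eq hcusp]
  exact ext fun p => mem_standardCuspidal_iff.symm

/-! ### Escape of the trajectories of the normal form for `a b ≥ 0` -/

section Escape

variable {γ : ℝ → Space} {I : Set ℝ} {b : ℝ}

lemma escapesBothWays_of_pos (hb : 0 < b) (h : IsTrajectory (normalField (3 / 2) b) γ I) :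
    EscapesBothWays γ I := by
  have hsign : (∀ u : ℝ, 0 ≤ 3 / 2 * u ^ 2 + b) ∨ ∀ u : ℝ, 3 / 2 * u ^ 2 + b ≤ 0 :=
    Or.inl fun u => by positivity
  exact escapesBothWays_of_not_returnsForward
    (fun hret => hb.ne' (h.tendsto_zero_of_forcing_signed hret hsign).1)
    (fun hret => hb.ne' (h.reverse.tendsto_zero_of_forcing_signed hret hsign).1)

lemma IsTrajectory.mem_standardCuspidal (h : IsTrajectory (normalField (3 / 2) 0) γ I)
    (hret : ReturnsForward γ I) {t : ℝ} (ht : t ∈ I) : γ t ∈ standardCuspidal := by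
  obtain ⟨-, hu, hv⟩ :=
    h.tendsto_zero_of_forcing_signed hret (Or.inl fun u => by positivity)
  have hlim : Tendsto (fun s => energy (3 / 2) 0 (γ s)) atTop (𝓝 0) := by
    simpa [energy] using
      (hv.pow 2).sub ((hu.pow 3).const_mul (2 * (3 / 2) / 3))
  have hconst : (fun s => energy (3 / 2) 0 (γ s)) =ᶠ[atTop] fun _ => energy (3 / 2) 0 (γ t) :=
    (h.eventually_mem (contDiff_normalField _ _) hret).mono fun s hs => h.energy_eq hs ht
  exact mem_standardCuspidal_iff.2
    (tendsto_nhds_unique (tendsto_const_nhds.congr' hconst.symm) hlim)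

lemma escapesBothWays_of_notMem_standardCuspidal (h : IsTrajectory (normalField (3 / 2) 0) γ I)
    (hS : ∀ t ∈ I, γ t ∉ standardCuspidal) : EscapesBothWays γ I := by
  obtain ⟨t, ht⟩ := h.nonempty
  refine escapesBothWays_of_not_returnsForward
    (fun hret => hS t ht (h.mem_standardCuspidal hret ht)) fun hret => hS t ht ?_
  have hmem := h.reverse.mem_standardCuspidal hret (t := -t) (by simpa using ht)
  simpa [reflect, standardCuspidal] using hmem

lemma IsTrajectory.eq_of_linear (h : IsTrajectory (normalField 0 b) γ I)
    (hret : ReturnsForward γ I) {s t : ℝ} (hs : s ∈ I) (ht : t ∈ I) : γ s = γ t := by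
  obtain ⟨rfl, hulim, hvlim⟩ := h.tendsto_zero_of_forcing_signed hret (by simpa using le_total 0 b)
  have hd q (hq : q ∈ I) := hasDerivAt_normalField_iff.1 (h.hasDerivAt q hq)
  have hI := h.eventually_mem (contDiff_normalField _ _) hret
  have hzero (i : Fin 3) (hi : ∀ q ∈ I, HasDerivAt (fun r => γ r i) 0 q)
      (hlim : Tendsto (fun r => γ r i) atTop (𝓝 0)) (q : ℝ) (hq : q ∈ I) : γ q i = 0 :=
    tendsto_nhds_unique (tendsto_const_nhds.congr' (hI.mono fun r hr =>
      eq_of_hasDerivAt_zero h.isOpen h.ordConnected hi hq hr)) hlim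
  have hv := hzero 2 (fun q hq => by simpa using (hd q hq).2.2) hvlim
  have hu := hzero 1 (fun q hq => by simpa [hv q hq] using (hd q hq).2.1) hulim
  have hx : γ s 0 = γ t 0 := eq_of_hasDerivAt_zero h.isOpen h.ordConnected
    (f := fun r => γ r 0) (fun q hq => by simpa [hu q hq] using (hd q hq).1) hs ht
  ext i
  fin_cases i
  · exact hx
  · exact (hu s hs).trans (hu t ht).symm
  · exact (hv s hs).trans (hv t ht).symm

lemma escapesBothWays_of_linear (h : IsTrajectory (normalField 0 b) γ I)
    (hn : IsNontrivial γ I) : EscapesBothWays γ I := by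
  obtain ⟨s, hs, t, ht, hne⟩ := hn
  refine escapesBothWays_of_not_returnsForward (fun hret => hne (h.eq_of_linear hret hs ht))
    fun hret => hne ?_
  have heq := h.reverse.eq_of_linear hret (s := -s) (t := -t) (by simpa using hs)
    (by simpa using ht)
  simpa [reflect_reflect] using congrArg reflect heq

end Escape

/-! ### Reduction to the normal form -/

lemma IsPolynomialMap.contDiff {σ τ : Type*} [Fintype σ] [Fintype τ] {e : (σ → ℝ) → τ → ℝ}
    (he : IsPolynomialMap e) {n : WithTop ℕ∞} : ContDiff ℝ n e := by
  obtain ⟨Q, hQ⟩ := he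
  refine contDiff_pi.2 fun i => ?_
  simp only [hQ]
  exact (AnalyticOnNhd.eval_mvPolynomial (Q i)).contDiff

lemma fderiv_apply_of_eval {σ τ : Type*} [Fintype σ] [Finite τ] {e : (σ → ℝ) → τ → ℝ}
    {Q : τ → MvPolynomial σ ℝ} (hQ : ∀ p i, e p i = MvPolynomial.eval p (Q i)) (p v : σ → ℝ)
    (i : τ) : fderiv ℝ e p v i = ∑ j, v j * MvPolynomial.eval p (MvPolynomial.pderiv j (Q i)) := by
  have := Fintype.ofFinite τ
  have he : DifferentiableAt ℝ e p :=
    (IsPolynomialMap.contDiff ⟨Q, hQ⟩ (n := 1)).differentiable one_ne_zero p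
  rw [← fderiv_eval_apply, ← funext fun q => hQ q i, fderiv_apply he]
  rfl

lemma eval_aeval {σ R : Type*} [CommSemiring R] (A : Polynomial R) (f : MvPolynomial σ R)
    (p : σ → R) :
    MvPolynomial.eval p (Polynomial.aeval f A) = A.eval (MvPolynomial.eval p f) :=
  (Polynomial.aeval_algHom_apply (MvPolynomial.aeval p) f A).symm

lemma eval_eq_leadingCoeff_mul_add {R : Type*} [Semiring R] {P : Polynomial R}
    (hP : P.natDegree = 1) (x : R) : P.eval x = P.leadingCoeff * x + P.coeff 0 := by
  rw [Polynomial.eval_eq_sum_range, Polynomial.leadingCoeff, hP, Finset.sum_range_succ,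
    Finset.sum_range_one, pow_zero, pow_one, mul_one, add_comm]

lemma leadingCoeff_ne_zero_of_natDegree_pos {R : Type*} [Semiring R] {P : Polynomial R}
    (hP : 0 < P.natDegree) : P.leadingCoeff ≠ 0 :=
  Polynomial.leadingCoeff_ne_zero.2 (Polynomial.ne_zero_of_natDegree_gt hP)

lemma eval_derivative_eq_leadingCoeff {R : Type*} [Semiring R] {P : Polynomial R}
    (hP : P.natDegree = 1) (x : R) : P.derivative.eval x = P.leadingCoeff := by
  rw [Polynomial.eq_X_add_C_of_natDegree_le_one hP.le, Polynomial.leadingCoeff_linear]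
  · simp
  · rw [← hP]
    exact leadingCoeff_ne_zero_of_natDegree_pos (hP ▸ one_pos)

section Straighten

variable {l : ℝ} {P₁ P₂ A₁ A₂ : Polynomial ℝ} {A₃ : ℝ}

/-- The polynomial automorphism `(x, y, z) ↦ (l x, l x', l x'')` of `ℝ³`, where `x'` and `x''` are
the derivatives of `x` along the trajectories of `field P₁ P₂ A₁ A₂ A₃`; in these coordinates the
system becomes a single third-order equation for `x`. -/
noncomputable def straighten (A₁ A₂ : Polynomial ℝ) (hl : l ≠ 0) (hP₁ : P₁.natDegree = 1)
    (hP₂ : P₂.natDegree = 1) : Space ≃ Space where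
  toFun s := ![l * s 0, l * P₁.eval (s 1 + A₁.eval (s 0)),
    l * P₁.leadingCoeff * P₂.eval (s 2 + P₂.leadingCoeff⁻¹ * A₂.eval (s 0))]
  invFun s := ![l⁻¹ * s 0,
    P₁.leadingCoeff⁻¹ * (l⁻¹ * s 1 - P₁.coeff 0) - A₁.eval (l⁻¹ * s 0),
    P₂.leadingCoeff⁻¹ * ((l * P₁.leadingCoeff)⁻¹ * s 2 - P₂.coeff 0) -
      P₂.leadingCoeff⁻¹ * A₂.eval (l⁻¹ * s 0)]
  left_inv s := by
    have hp := leadingCoeff_ne_zero_of_natDegree_pos (hP₁ ▸ one_pos)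
    have hq := leadingCoeff_ne_zero_of_natDegree_pos (hP₂ ▸ one_pos)
    ext i
    fin_cases i
    · simp [hl]
    · simp [eval_eq_leadingCoeff_mul_add hP₁, hl, hp]
    · simp [eval_eq_leadingCoeff_mul_add hP₂, hl, hp, hq, -mul_inv_rev]
  right_inv s := by
    have hp := leadingCoeff_ne_zero_of_natDegree_pos (hP₁ ▸ one_pos)
    have hq := leadingCoeff_ne_zero_of_natDegree_pos (hP₂ ▸ one_pos)
    ext i
    fin_cases i
    · simp [hl]
    · simp [eval_eq_leadingCoeff_mul_add hP₁, hl, hp]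
    · simp [eval_eq_leadingCoeff_mul_add hP₂, hl, hp, hq, mul_assoc]

/-- The components of `straighten` as polynomials. -/
noncomputable def straightenPoly (l : ℝ) (P₁ P₂ A₁ A₂ : Polynomial ℝ) :
    Fin 3 → MvPolynomial (Fin 3) ℝ :=
  open MvPolynomial in
  ![C l * X 0, C l * Polynomial.aeval (X 1 + Polynomial.aeval (X 0) A₁) P₁,
    C (l * P₁.leadingCoeff) *
      Polynomial.aeval (X 2 + C P₂.leadingCoeff⁻¹ * Polynomial.aeval (X 0) A₂) P₂]

variable (hl : l ≠ 0) (hP₁ : P₁.natDegree = 1) (hP₂ : P₂.natDegree = 1)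

lemma straighten_apply_eq_eval (s : Space) (i : Fin 3) :
    straighten A₁ A₂ hl hP₁ hP₂ s i =
      MvPolynomial.eval s (straightenPoly l P₁ P₂ A₁ A₂ i) := by
  fin_cases i <;> simp [straighten, straightenPoly, eval_aeval]

lemma isPolynomialMap_straighten : IsPolynomialMap (straighten A₁ A₂ hl hP₁ hP₂) :=
  ⟨_, straighten_apply_eq_eval hl hP₁ hP₂⟩

open MvPolynomial in
lemma isPolynomialMap_straighten_symm : IsPolynomialMap (straighten A₁ A₂ hl hP₁ hP₂).symm := by
  refine ⟨![C l⁻¹ * X 0,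
    C P₁.leadingCoeff⁻¹ * (C l⁻¹ * X 1 - C (P₁.coeff 0)) - Polynomial.aeval (C l⁻¹ * X 0) A₁,
    C P₂.leadingCoeff⁻¹ * (C (l * P₁.leadingCoeff)⁻¹ * X 2 - C (P₂.coeff 0)) -
      C P₂.leadingCoeff⁻¹ * Polynomial.aeval (C l⁻¹ * X 0) A₂], fun s i => ?_⟩
  fin_cases i <;> simp [straighten, eval_aeval]

-- The terms of `F₂` and `F₃` containing `A₂` cancel in `x'''`.
lemma fderiv_straighten_field (s : Space) :
    fderiv ℝ (straighten A₁ A₂ hl hP₁ hP₂) s (field P₁ P₂ A₁ A₂ A₃ s) =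
      ![straighten A₁ A₂ hl hP₁ hP₂ s 1, straighten A₁ A₂ hl hP₁ hP₂ s 2,
        P₁.leadingCoeff / (2 * l) * A₁.derivative.derivative.eval (s 0) *
          straighten A₁ A₂ hl hP₁ hP₂ s 1 ^ 2 +
        l * P₁.leadingCoeff * P₂.leadingCoeff * A₃] := by
  have hp := leadingCoeff_ne_zero_of_natDegree_pos (hP₁ ▸ one_pos)
  have hq := leadingCoeff_ne_zero_of_natDegree_pos (hP₂ ▸ one_pos)
  ext i
  rw [fderiv_apply_of_eval (straighten_apply_eq_eval hl hP₁ hP₂), Fin.sum_univ_three]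
  fin_cases i
  · simp [straightenPoly, straighten, field, F₁, mul_comm]
  · simp [straightenPoly, straighten, field, F₁, F₂, Derivation.map_aeval, eval_aeval, hP₂,
      eval_derivative_eq_leadingCoeff hP₁]
    ring
  · simp [straightenPoly, straighten, field, F₁, F₃, Derivation.map_aeval, eval_aeval, hP₂,
      eval_derivative_eq_leadingCoeff hP₂]
    field_simp
    ring

lemma isConj_straighten {a : ℝ}
    (ha : ∀ x, P₁.leadingCoeff * A₁.derivative.derivative.eval x = 2 * l * a) :
    IsConj (straighten A₁ A₂ hl hP₁ hP₂) (field P₁ P₂ A₁ A₂ A₃)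
      (normalField a (l * P₁.leadingCoeff * P₂.leadingCoeff * A₃)) := by
  refine ⟨(isPolynomialMap_straighten hl hP₁ hP₂).contDiff,
    (isPolynomialMap_straighten_symm hl hP₁ hP₂).contDiff, fun s => ?_⟩
  rw [fderiv_straighten_field, div_mul_eq_mul_div, ha, mul_div_cancel_left₀ _ (by simpa using hl)]
  rfl

lemma exists_isConj_of_natDegree_le_one {P₁ P₂ A₁ : Polynomial ℝ} (A₂ : Polynomial ℝ) (A₃ : ℝ)
    (hP₁ : P₁.natDegree = 1) (hP₂ : P₂.natDegree = 1) (hA₁ : A₁.natDegree ≤ 1) :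
    ∃ e b, IsConj e (field P₁ P₂ A₁ A₂ A₃) (normalField 0 b) := by
  refine ⟨_, _, isConj_straighten one_ne_zero hP₁ hP₂ fun x => ?_⟩
  have hA₁'' : A₁.derivative.derivative = 0 :=
    Polynomial.iterate_derivative_eq_zero (x := 2) (by omega)
  rw [hA₁'', Polynomial.eval_zero, mul_zero, mul_zero]

lemma exists_isConj_of_natDegree_eq_two {P₁ P₂ A₁ : Polynomial ℝ} (A₂ : Polynomial ℝ) (A₃ : ℝ)
    (hP₁ : P₁.natDegree = 1) (hP₂ : P₂.natDegree = 1) (hA₁ : A₁.natDegree = 2) :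
    ∃ e : Space ≃ Space, IsPolynomialMap e ∧ IsPolynomialMap e.symm ∧
      IsConj e (field P₁ P₂ A₁ A₂ A₃) (normalField (3 / 2) (2 / 3 * mu P₁ P₂ A₁ A₃)) := by
  have hp := leadingCoeff_ne_zero_of_natDegree_pos (hP₁ ▸ one_pos)
  have ha : A₁.coeff 2 ≠ 0 := hA₁ ▸ leadingCoeff_ne_zero_of_natDegree_pos (hA₁ ▸ two_pos)
  have hl : 2 / 3 * (P₁.leadingCoeff * A₁.coeff 2) ≠ 0 := by positivity
  refine ⟨_, isPolynomialMap_straighten (A₁ := A₁) (A₂ := A₂) hl hP₁ hP₂,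
    isPolynomialMap_straighten_symm hl hP₁ hP₂, ?_⟩
  convert isConj_straighten hl hP₁ hP₂ (a := 3 / 2) fun x => ?_ using 2
  · rw [mu]
    ring
  · have hA₁' : A₁.derivative.natDegree = 1 := by
      rw [Polynomial.natDegree_derivative, hA₁]
    rw [eval_derivative_eq_leadingCoeff hA₁', ← Polynomial.coeff_natDegree (p := A₁.derivative),
      hA₁', Polynomial.coeff_derivative]
    norm_num
    ring

end Straighten

lemma IsNontrivial.comp {γ : ℝ → Space} {I : Set ℝ} (h : IsNontrivial γ I) {f : Space → Space}
    (hf : Function.Injective f) : IsNontrivial (f ∘ γ) I :=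
  let ⟨s, hs, t, ht, hne⟩ := h
  ⟨s, hs, t, ht, hf.ne hne⟩

namespace IsConj

variable {e : Space ≃ Space} {F G : Space → Space} {S : Set Space}

lemma isCuspidalInvariantSurface (h : IsConj e F G) (hpoly : IsPolynomialMap e.symm)
    (hS : IsCuspidalInvariantSurface F S) : IsCuspidalInvariantSurface G (e '' S) :=
  ⟨h.isInvariantAlgebraic hpoly hS.1, hS.2.image h.contDiff h.contDiff_symm⟩

lemma escapesBothWays (h : IsConj e F G)
    (hesc : ∀ γ I, IsTrajectory G γ I → (∀ t ∈ I, γ t ∉ S) → EscapesBothWays γ I)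
    (γ : ℝ → Space) (I : Set ℝ) (hγ : IsTrajectory F γ I) (hS : ∀ t ∈ I, γ t ∉ e.symm '' S) :
    EscapesBothWays γ I := by
  refine .of_comp h.contDiff.continuous (hesc _ I (h.isTrajectory hγ) fun t ht hmem => ?_)
  exact hS t ht ⟨_, hmem, e.symm_apply_apply _⟩

lemma nonempty_homeomorph (h : IsConj e F G) {X : Type*} [TopologicalSpace X]
    (hS : Nonempty (S ≃ₜ X)) : Nonempty (e '' S ≃ₜ X) := by
  let E : Space ≃ₜ Space := ⟨e, h.contDiff.continuous, h.contDiff_symm.continuous⟩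
  exact hS.map (E.image S).symm.trans

end IsConj

end NilpotentField

open NilpotentField in
theorem mainTheorem3_general (P₁ P₂ A₁ A₂ : Polynomial ℝ) (A₃ : ℝ)
    (hP₁ : P₁.natDegree = 1) (hP₂ : P₂.natDegree = 1) :
    (A₁.natDegree ≤ 1 →
      ∀ (γ : ℝ → Space) (I : Set ℝ),
        IsTrajectory (field P₁ P₂ A₁ A₂ A₃) γ I →
        IsNontrivial γ I → EscapesBothWays γ I) ∧
    (A₁.natDegree = 2 →
      (0 < mu P₁ P₂ A₁ A₃ →
        ∀ (γ : ℝ → Space) (I : Set ℝ),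
          IsTrajectory (field P₁ P₂ A₁ A₂ A₃) γ I →
          EscapesBothWays γ I) ∧
      (mu P₁ P₂ A₁ A₃ = 0 →
        ∃ S₀ : Set Space,
          IsCuspidalInvariantSurface
            (field P₁ P₂ A₁ A₂ A₃) S₀ ∧
          (∀ S : Set Space,
            IsCuspidalInvariantSurface
              (field P₁ P₂ A₁ A₂ A₃) S → S = S₀) ∧
          ∀ (γ : ℝ → Space) (I : Set ℝ),
            IsTrajectory (field P₁ P₂ A₁ A₂ A₃) γ I →
            (∀ t ∈ I, γ t ∉ S₀) → EscapesBothWays γ I) ∧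
      (mu P₁ P₂ A₁ A₃ < 0 →
        ∃ Sμ : Set Space,
          IsIsochronousPeriodicSurface
            (field P₁ P₂ A₁ A₂ A₃) Sμ ∧
          Nonempty (Sμ ≃ₜ ℝ × Circle) ∧
          (∀ S : Set Space,
            IsIsochronousPeriodicSurface
              (field P₁ P₂ A₁ A₂ A₃) S → S = Sμ) ∧
          ∀ (γ : ℝ → Space) (I : Set ℝ),
            IsTrajectory (field P₁ P₂ A₁ A₂ A₃) γ I →
            (∀ t ∈ I, γ t ∉ Sμ) → EscapesBothWays γ I)) := by
  refine ⟨fun hA₁ γ I hγ hn => ?_, fun hA₁ => ?_⟩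
  · obtain ⟨e, b, he⟩ := exists_isConj_of_natDegree_le_one A₂ A₃ hP₁ hP₂ hA₁
    exact .of_comp he.contDiff.continuous
      (escapesBothWays_of_linear (he.isTrajectory hγ) (hn.comp e.injective))
  obtain ⟨e, hpoly, hpoly', he⟩ := exists_isConj_of_natDegree_eq_two A₂ A₃ hP₁ hP₂ hA₁
  refine ⟨fun hμ γ I hγ => ?_, fun hμ => ?_, fun hμ => ?_⟩
  · exact .of_comp he.contDiff.continuous
      (escapesBothWays_of_pos (by positivity) (he.isTrajectory hγ))
  · rw [hμ, mul_zero] at he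
    exact ⟨e.symm '' standardCuspidal,
      he.symm.isCuspidalInvariantSurface hpoly
        ⟨isInvariantAlgebraic_standardCuspidal, isCuspidal_standardCuspidal⟩,
      fun S hS => by
        rw [← eq_standardCuspidal (he.isCuspidalInvariantSurface hpoly' hS), e.symm_image_image],
      he.escapesBothWays fun _ _ => escapesBothWays_of_notMem_standardCuspidal⟩
  · obtain ⟨S, hS, hcyl, huniq, hesc⟩ := exists_isochronousPeriodicSurface_normalField
      (show 2 / 3 * mu P₁ P₂ A₁ A₃ < 0 by linarith)
    exact ⟨e.symm '' S, he.symm.isIsochronousPeriodicSurface hS, he.symm.nonempty_homeomorph hcyl,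
      fun S' hS' => by
        rw [← huniq _ (he.isIsochronousPeriodicSurface hS'), e.symm_image_image],
      he.escapesBothWays hesc⟩

theorem mainTheorem3 (P₁ P₂ A₁ A₂ : Polynomial ℝ) (A₃ : ℝ)
    (hP₁ : P₁.natDegree = 1) (hP₂ : P₂.natDegree = 1) (hA₂ : A₂.natDegree ≤ 1) :
    (A₁.natDegree ≤ 1 →
      ∀ (γ : ℝ → NilpotentField.Space) (I : Set ℝ),
        NilpotentField.IsTrajectory (NilpotentField.field P₁ P₂ A₁ A₂ A₃) γ I →
        NilpotentField.IsNontrivial γ I → NilpotentField.EscapesBothWays γ I) ∧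
    (A₁.natDegree = 2 →
      (0 < NilpotentField.mu P₁ P₂ A₁ A₃ →
        ∀ (γ : ℝ → NilpotentField.Space) (I : Set ℝ),
          NilpotentField.IsTrajectory (NilpotentField.field P₁ P₂ A₁ A₂ A₃) γ I →
          NilpotentField.EscapesBothWays γ I) ∧
      (NilpotentField.mu P₁ P₂ A₁ A₃ = 0 →
        ∃ S₀ : Set NilpotentField.Space,
          NilpotentField.IsCuspidalInvariantSurface
            (NilpotentField.field P₁ P₂ A₁ A₂ A₃) S₀ ∧
          (∀ S : Set NilpotentField.Space,
            NilpotentField.IsCuspidalInvariantSurface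
              (NilpotentField.field P₁ P₂ A₁ A₂ A₃) S → S = S₀) ∧
          ∀ (γ : ℝ → NilpotentField.Space) (I : Set ℝ),
            NilpotentField.IsTrajectory (NilpotentField.field P₁ P₂ A₁ A₂ A₃) γ I →
            (∀ t ∈ I, γ t ∉ S₀) → NilpotentField.EscapesBothWays γ I) ∧
      (NilpotentField.mu P₁ P₂ A₁ A₃ < 0 →
        ∃ Sμ : Set NilpotentField.Space,
          NilpotentField.IsIsochronousPeriodicSurface
            (NilpotentField.field P₁ P₂ A₁ A₂ A₃) Sμ ∧
          Nonempty (Sμ ≃ₜ ℝ × Circle) ∧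
          (∀ S : Set NilpotentField.Space,
            NilpotentField.IsIsochronousPeriodicSurface
              (NilpotentField.field P₁ P₂ A₁ A₂ A₃) S → S = Sμ) ∧
          ∀ (γ : ℝ → NilpotentField.Space) (I : Set ℝ),
            NilpotentField.IsTrajectory (NilpotentField.field P₁ P₂ A₁ A₂ A₃) γ I →
            (∀ t ∈ I, γ t ∉ Sμ) → NilpotentField.EscapesBothWays γ I)) :=
  mainTheorem3_general P₁ P₂ A₁ A₂ A₃ hP₁ hP₂
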